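/- Functions on the circle $S^1=\mathbb R/\mathbb Z$ are regarded as $1$-periodic functions of $x\in\mathbb R$, and $\mu(f)=\int_0^1 f\,dx$. A smooth solution of the $\mu$B equation on $[0,T)$, $0<T<\infty$, is a function $u(t,x)$, $1$-periodic in $x$ and smooth on $[0,T)\times\mathbb R$, with $$u_{txx}+3u_xu_{xx}+uu_{xxx}=0. \qquad (\mu\mathrm B)$$ (The mean $\mu(u)$ is allowed to depend on time.) (1) If $u$ is a smooth solution on $[0,T)$ with $u(0,\cdot)=u_0$, then for all $t\in[0,T)$ and $p=1,2,3,\dots$ $$\int_0^1(u-\mu(u))^p\,dx=\int_0^1(u_0-\mu(u_0))^p\,dx .$$ (2) For every non-constant $u_0$ there is a finite $T_c>0$ such that every smooth solution $u$ on $[0,T)$ with $u(0,\cdot)=u_0$ satisfies: $T\le T_c$; if the mean $t\mapsto\mu(u(t))$ is the restriction of a smooth function on $[0,\infty)$ (for example, if it is conserved), then $u$ extends to a smooth solution on $[0,T_c)$; and if $T=T_c$, then $\|u_x(t)\|_\infty\nearrow\infty$ as $t\nearrow T_c$, that is, $\|u_x(t)\|_\infty\to\infty$ as $t\nearrow T_c$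 and $t\mapsto \|u_x(t)\|_\infty$ is strictly increasing on some interval $[t_0,T_c)$ with $0\le t_0<T_c$. (3) With $m=-u_{xx}$, the $\mu$B equation has the bihamiltonian structure given by $$H_0=-\tfrac92\int_0^1 m\,dx,\quad H_2=-\tfrac16\int_0^1u^3dx,\quad J_0=-m^{2/3}\partial_xm^{1/3}\,\partial_x^{-3}\,m^{1/3}\partial_xm^{2/3},\quad J_2=\partial_x^5 ,$$ in the following sense. The factors of $J_0$ are the operators $m^{2/3}\partial_xm^{1/3}=m\partial_x+\tfrac13m_x$ and $m^{1/3}\partial_xm^{2/3}=m\partial_x+\tfrac23m_x$. For $\kappa\in\mathbb R$ let $J_0^{\kappa}$ be $J_0$ with $\partial_x^{-3}h$ read as the periodic function $w$ of mean $\kappa$ with $w_{xxx}=h-\mu(h)$, so that $\kappa$ is the constant of integration. Let $\mathcal A$ be the space of the functionals $F$ of $m\in C^\infty(S^1)$ that are invariant under the translations of $S^1$ and have a variational derivative $\delta F/\delta m\in C^\infty(S^1)$ which depends smoothly on $m$ (it maps families of functions depending smoothly on finitely many parameters to such families). For an operator $J$ depending on $m$ put $\{F,G\}_J=\int_0^1\frac{\delta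 F}{\delta m}\,J\,\frac{\delta G}{\delta m}\,dx$. (a) $J_0^0$ and $J_2$ are compatible Hamiltonian operators: for all $a,b\in\mathbb R$ the operator $J=aJ_0^0+bJ_2$ on $C^\infty(S^1)$ is linear and skew-adjoint, $\mathcal A$ is closed under $\{\cdot,\cdot\}_J$, and $\{\cdot,\cdot\}_J$ satisfies the Jacobi identity on $\mathcal A$. (b) For $F,G\in\mathcal A$ the function $m^{1/3}\partial_xm^{2/3}\frac{\delta G}{\delta m}$, to which $\partial_x^{-3}$ is applied, has zero mean, and $\{F,G\}_{J_0^\kappa}=\{F,G\}_{J_0^0}$ for all $\kappa$. (c) For $c\in\mathbb R$ regard $H_2$ as the functional of $m$ for which $u$ is the function with $\mu(u)=c$ and $-u_{xx}=m-\mu(m)$. Then $H_0$ and $H_2$ belong to $\mathcal A$, and for every smooth $u$ on $S^1$, with $m=-u_{xx}$, $c=\mu(u)$ and $\kappa=3\mu(u)$, $$J_0^{\kappa}\frac{\delta H_0}{\delta m}=J_2\frac{\delta H_2}{\delta m}=-um_x-3u_xm .$$ Hence, for every function $u(t,x)$ that is smooth on $[0,T)\times\mathbb R$ and $1$-periodic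 in $x$, the $\mu$B equation is equivalent to $m_t=J_0^{\kappa}\frac{\delta H_0}{\delta m}$ and also to $m_t=J_2\frac{\delta H_2}{\delta m}$, again with $c=\mu(u)$ and $\kappa=3\mu(u)$ at each time. -/

import Mathlib

open Set Filter Topology
open scoped ContDiff

namespace MuBurgers

/-! ### Functions on the circle `ℝ / ℤ` -/

/-- Smooth functions on the circle, as smooth `1`-periodic functions on `ℝ`. -/
def IsSmoothPeriodic (f : ℝ → ℝ) : Prop :=
  ContDiff ℝ ∞ f ∧ Function.Periodic f 1

/-- The mean `μ(f) = ∫₀¹ f dx`. -/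
noncomputable def mean (f : ℝ → ℝ) : ℝ := ∫ x in (0 : ℝ)..1, f x

/-- The sup norm of a (bounded) function. -/
noncomputable def supNorm (f : ℝ → ℝ) : ℝ := ⨆ x, |f x|

/-- The momentum `m = -u_xx`. -/
noncomputable def momentum (u : ℝ → ℝ) : ℝ → ℝ := fun x => -iteratedDeriv 2 u x

/-- The inverse of `∂_x` on functions of zero mean: for smooth periodic `h` of zero mean, `invD h`
is the unique periodic function of zero mean with derivative `h`. (For other `h` the mean of `h`
is subtracted first.) -/
noncomputable def invD (h : ℝ → ℝ) : ℝ → ℝ :=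
  fun x => (∫ y in (0 : ℝ)..x, (h y - mean h))
    - mean (fun z => ∫ y in (0 : ℝ)..z, (h y - mean h))

/-! ### Smooth solutions of the μB equation -/

/-- `u` is smooth on `[0, T) × ℝ` (up to and including `t = 0`) and `1`-periodic in space. -/
def IsSmoothCurve (T : ℝ) (u : ℝ → ℝ → ℝ) : Prop :=
  0 < T ∧ ContDiffOn ℝ ∞ (fun p : ℝ × ℝ => u p.1 p.2) (Ico 0 T ×ˢ univ) ∧
    ∀ t ∈ Ico 0 T, Function.Periodic (u t) 1

/-- The time derivative on `[0, T)`, one-sided at `t = 0`. -/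
noncomputable def timeDeriv (T : ℝ) (v : ℝ → ℝ → ℝ) (t x : ℝ) : ℝ :=
  derivWithin (fun s => v s x) (Ico 0 T) t

/-- Smooth solutions on `[0, T)` of the μB equation `u_txx + 3 u_x u_xx + u u_xxx = 0`. -/
def IsMuBSolution (T : ℝ) (u : ℝ → ℝ → ℝ) : Prop :=
  IsSmoothCurve T u ∧ ∀ t ∈ Ico 0 T, ∀ x : ℝ,
    iteratedDeriv 2 (timeDeriv T u t) x + 3 * deriv (u t) x * iteratedDeriv 2 (u t) x
      + u t x * iteratedDeriv 3 (u t) x = 0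

/-! ### Functionals and Hamiltonian operators -/

/-- A family of smooth functions on the circle depending smoothly on finitely many parameters. -/
def IsSmoothFamily {k : ℕ} (γ : (Fin k → ℝ) → ℝ → ℝ) : Prop :=
  ContDiff ℝ ∞ (fun p : (Fin k → ℝ) × ℝ => γ p.1 p.2) ∧ ∀ s, Function.Periodic (γ s) 1

/-- `g = δF/δm` on the space of smooth functions on the circle. -/
def IsVariationalDerivative (F : (ℝ → ℝ) → ℝ) (g : (ℝ → ℝ) → ℝ → ℝ) : Prop :=
  ∀ m v : ℝ → ℝ, IsSmoothPeriodic m → IsSmoothPeriodic v →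
    HasDerivAt (fun ε : ℝ => F (fun x => m x + ε * v x)) (∫ x in (0 : ℝ)..1, g m x * v x) 0

/-- `F` is a smooth functional of `m`, invariant under the translations `x ↦ x + a` of the circle,
with variational derivative `δF/δm = g`. Smoothness means that `g` turns smooth families of
functions into smooth families. -/
structure IsFunctional (F : (ℝ → ℝ) → ℝ) (g : (ℝ → ℝ) → ℝ → ℝ) : Prop where
  variation : IsVariationalDerivative F g
  smooth : ∀ (k : ℕ) (γ : (Fin k → ℝ) → ℝ → ℝ), IsSmoothFamily γ →
    IsSmoothFamily (fun s => g (γ s))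
  translation : ∀ m : ℝ → ℝ, IsSmoothPeriodic m → ∀ a : ℝ, F (fun x => m (x + a)) = F m

/-- The bracket `{F, G}(m) = ∫ (δF/δm) J_m (δG/δm) dx`, in terms of `f = δF/δm`, `g = δG/δm`. -/
noncomputable def bracket (J : (ℝ → ℝ) → (ℝ → ℝ) → ℝ → ℝ) (f g : (ℝ → ℝ) → ℝ → ℝ)
    (m : ℝ → ℝ) : ℝ :=
  ∫ x in (0 : ℝ)..1, f m x * J m (g m) x

/-- `J` is a Hamiltonian operator: each `J_m` is a linear skew-adjoint operator on smooth functions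
on the circle, and `{F, G} = ∫ (δF/δm) J_m (δG/δm) dx` is a Lie bracket on the space of
translation-invariant smooth functionals of `m`. -/
structure IsHamiltonian (J : (ℝ → ℝ) → (ℝ → ℝ) → ℝ → ℝ) : Prop where
  smooth : ∀ m f, IsSmoothPeriodic m → IsSmoothPeriodic f → IsSmoothPeriodic (J m f)
  linear : ∀ m f g, IsSmoothPeriodic m → IsSmoothPeriodic f → IsSmoothPeriodic g → ∀ c x : ℝ,
    J m (fun y => f y + c * g y) x = J m f x + c * J m g x
  skew : ∀ m f g, IsSmoothPeriodic m → IsSmoothPeriodic f → IsSmoothPeriodic g →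
    ∫ x in (0 : ℝ)..1, f x * J m g x = -∫ x in (0 : ℝ)..1, g x * J m f x
  closed : ∀ F G f g, IsFunctional F f → IsFunctional G g → ∃ k, IsFunctional (bracket J f g) k
  jacobi : ∀ F G H f g h fg gh hf, IsFunctional F f → IsFunctional G g → IsFunctional H h →
    IsFunctional (bracket J f g) fg → IsFunctional (bracket J g h) gh →
    IsFunctional (bracket J h f) hf → ∀ m, IsSmoothPeriodic m →
      bracket J fg h m + bracket J gh f m + bracket J hf g m = 0

/-! ### The operators and functionals of the μB equation -/

/-- The real cube root. -/
noncomputable def cbrt (y : ℝ) : ℝ := SignType.sign y * |y| ^ (1 / 3 : ℝ)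

/-- The operator `m^{2/3} ∂_x m^{1/3}`, i.e. `f ↦ m f_x + (1/3) m_x f`. The expanded form makes
sense also at the zeros of `m`; for the factored form see `outerOp_eq`. -/
noncomputable def outerOp (m f : ℝ → ℝ) : ℝ → ℝ :=
  fun x => m x * deriv f x + 1 / 3 * deriv m x * f x

/-- The operator `m^{1/3} ∂_x m^{2/3}`, i.e. `f ↦ m f_x + (2/3) m_x f`; for the factored form see
`innerOp_eq`. -/
noncomputable def innerOp (m f : ℝ → ℝ) : ℝ → ℝ :=
  fun x => m x * deriv f x + 2 / 3 * deriv m x * f x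

/-- `J₀ = -m^{2/3} ∂_x m^{1/3} ∂_x^{-3} m^{1/3} ∂_x m^{2/3}`, where `∂_x^{-3}` is the
periodic threefold antiderivative of mean `κ`. -/
noncomputable def J0 (κ : ℝ) (m f : ℝ → ℝ) : ℝ → ℝ :=
  fun x => -outerOp m (fun y => invD^[3] (innerOp m f) y + κ) x

/-- `J₂ = ∂_x^5`. -/
noncomputable def J2 (_m f : ℝ → ℝ) : ℝ → ℝ := iteratedDeriv 5 f

/-- `H₀ = -(9/2) ∫ m dx`. -/
noncomputable def H0 (m : ℝ → ℝ) : ℝ := -(9 / 2) * ∫ x in (0 : ℝ)..1, m x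

/-- The velocity `u` of mean `c` with momentum `-u_xx = m` (for `m` of zero mean; of a
general `m` the mean is discarded). -/
noncomputable def velocity (c : ℝ) (m : ℝ → ℝ) : ℝ → ℝ := fun x => c - invD^[2] m x

/-- `H₂ = -(1/6) ∫ u³ dx` as a functional of `m`, where `u` has mean `c`. -/
noncomputable def H2 (c : ℝ) (m : ℝ → ℝ) : ℝ :=
  -(1 / 6) * ∫ x in (0 : ℝ)..1, velocity c m x ^ 3

theorem cbrt_pow_three (y : ℝ) : cbrt y ^ 3 = y := by
  have h : (|y| ^ (1 / 3 : ℝ)) ^ 3 = |y| := by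
    rw [← Real.rpow_natCast, ← Real.rpow_mul (abs_nonneg y)]
    norm_num
  unfold cbrt
  rw [mul_pow, h]
  rcases lt_trichotomy y 0 with hy | hy | hy
  · simp [sign_neg hy, abs_of_neg hy]; ring
  · simp [hy]
  · simp [sign_pos hy, abs_of_pos hy]

theorem differentiableAt_cbrt {y : ℝ} (hy : y ≠ 0) : DifferentiableAt ℝ cbrt y := by
  have h2 : DifferentiableAt ℝ (fun z : ℝ => |z| ^ (1 / 3 : ℝ)) y :=
    (differentiableAt_abs hy).rpow_const (Or.inl (abs_ne_zero.mpr hy))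
  rcases lt_or_gt_of_ne hy with h | h
  · refine (h2.const_mul (-1)).congr_of_eventuallyEq ?_
    filter_upwards [gt_mem_nhds h] with z hz
    simp [cbrt, sign_neg hz]
  · refine (h2.const_mul 1).congr_of_eventuallyEq ?_
    filter_upwards [lt_mem_nhds h] with z hz
    simp [cbrt, sign_pos hz]

theorem deriv_cbrt_comp {m : ℝ → ℝ} {x : ℝ} (hm : DifferentiableAt ℝ m x) (hx : m x ≠ 0) :
    DifferentiableAt ℝ (fun y => cbrt (m y)) x ∧
      deriv m x = 3 * cbrt (m x) ^ 2 * deriv (fun y => cbrt (m y)) x := by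
  have hc : DifferentiableAt ℝ (fun y => cbrt (m y)) x :=
    DifferentiableAt.comp x (differentiableAt_cbrt hx) hm
  refine ⟨hc, ?_⟩
  have h := (hc.hasDerivAt.pow 3).deriv
  have e : (fun y => cbrt (m y)) ^ 3 = m := funext fun y => cbrt_pow_three (m y)
  rw [e] at h
  rw [h]; norm_num

/-- `outerOp m` is the operator `m^{2/3} ∂_x m^{1/3}` wherever `m` does not vanish. -/
theorem outerOp_eq {m f : ℝ → ℝ} {x : ℝ} (hm : DifferentiableAt ℝ m x)
    (hf : DifferentiableAt ℝ f x) (hx : m x ≠ 0) :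
    outerOp m f x = cbrt (m x) ^ 2 * deriv (fun y => cbrt (m y) * f y) x := by
  obtain ⟨hc, h⟩ := deriv_cbrt_comp hm hx
  have h2 := (hc.hasDerivAt.mul hf.hasDerivAt).deriv
  have e : ((fun y => cbrt (m y)) * f) = fun y => cbrt (m y) * f y := rfl
  rw [e] at h2
  rw [h2, outerOp, h]
  linear_combination (-deriv f x) * cbrt_pow_three (m x)

/-- `innerOp m` is the operator `m^{1/3} ∂_x m^{2/3}` wherever `m` does not vanish. -/
theorem innerOp_eq {m f : ℝ → ℝ} {x : ℝ} (hm : DifferentiableAt ℝ m x)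
    (hf : DifferentiableAt ℝ f x) (hx : m x ≠ 0) :
    innerOp m f x = cbrt (m x) * deriv (fun y => cbrt (m y) ^ 2 * f y) x := by
  obtain ⟨hc, h⟩ := deriv_cbrt_comp hm hx
  have h2 := ((hc.hasDerivAt.pow 2).mul hf.hasDerivAt).deriv
  have e : ((fun y => cbrt (m y)) ^ 2 * f) = fun y => cbrt (m y) ^ 2 * f y := rfl
  rw [e] at h2
  rw [h2, innerOp, h]
  simp only [Pi.pow_apply]
  push_cast
  linear_combination (-deriv f x) * cbrt_pow_three (m x)

end MuBurgers

open MuBurgers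

/-! The dynamical claims rest on the fact that the μB equation is the second `x`-derivative of `u_t
+ u u_x`. By periodicity it says that `u_t + u u_x` depends on time alone
(`IsSmoothCurve.isMuBSolution_iff_burgers`), so it is the inviscid Burgers equation with a spatially
constant force. With `v = u₀ - μ(u₀)`, the function `u - μ(u)` is constant, equal to `v(y)`, along
the explicit characteristic `y + t v(y) + ∫₀ᵗ μ(u)` (`IsMuBSolution.characteristics`).

Changing variables by this map gives `∫ (u - μ(u))^p = ∫ v^p (1 + t v')`, and `v^p v'` is exact.
Differentiating in `y` gives `u_x (1 + t u₀') = u₀'` along characteristics. If `-a < 0` is the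
minimum of `u₀'`, this is contradictory at `t = 1/a`, so `Tc = 1/a`. Close to that time the steepest
negative slope dominates and `‖u_x‖_∞ = a / (1 - t a)`. Before it, `y ↦ y + t v(y)` is a
diffeomorphism, and its inverse gives the solution with any prescribed smooth mean
(`isMuBSolution_burgersFlow`).

For the Hamiltonian part, the derivative of `{F, G}` along the vector field `J δH` consists of
Hessian terms and a term from the dependence of `J₀` on `m` (`hasDerivAt_bracket_pencil`). In the
cyclic sum the Hessian terms cancel, because Hessians are symmetric and `J` is skew. What remains is
an integral in the gradients `f, g, h` and the antiderivatives `A, B, C`, with `A''' = m f' + (2/3)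
m' f` and likewise for `B` and `C`. These relations need the right-hand sides to have zero mean,
which is infinitesimal translation invariance, `∫ (δF/δm) m_x = 0`. The remainder has a part
quadratic in `J₀`, the derivative of the Wronskian of `A, B, C`, and a mixed part from `J₀` and
`J₂`, which is exact by repeated integration by parts (`mean_jacobi_J0`, `mean_jacobi_J2`). Both
vanish separately, so every linear combination is Hamiltonian.

The two Hamiltonian forms of the equation follow by computing the gradients `-9/2` and `(1/2) ∂_x⁻²
u²`. -/

namespace MuBurgers

/-! ### Integrals depending on a parameter -/

section Parametric

variable {E : Type*} [NormedAddCommGroup E] [NormedSpace ℝ E] [FiniteDimensional ℝ E]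

theorem hasFDerivAt_intervalIntegral_param {h : E × ℝ → ℝ} (hh : ContDiff ℝ 1 h) (a b : ℝ)
    (s₀ : E) :
    HasFDerivAt (fun s => ∫ x in a..b, h (s, x))
      (∫ x in a..b, (fderiv ℝ h (s₀, x)).comp (ContinuousLinearMap.inl ℝ E ℝ)) s₀ := by
  have hcont : Continuous fun p : E × ℝ =>
      (fderiv ℝ h p).comp (ContinuousLinearMap.inl ℝ E ℝ) :=
    (hh.continuous_fderiv one_ne_zero).clm_comp continuous_const
  -- The dominating constant comes from compactness of the unit ball times the interval; this is
  -- where finite dimension enters.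
  obtain ⟨C, hC⟩ := ((isCompact_closedBall s₀ 1).prod (isCompact_uIcc (a := a) (b := b))).bddAbove_image
    hcont.norm.continuousOn
  refine intervalIntegral.hasFDerivAt_integral_of_dominated_of_fderiv_le
    (s := Metric.ball s₀ 1) (bound := fun _ => C)
    (F' := fun s x => (fderiv ℝ h (s, x)).comp (ContinuousLinearMap.inl ℝ E ℝ))
    (Metric.ball_mem_nhds _ one_pos) ?_ ?_ ?_ ?_ ?_ ?_
  · exact Eventually.of_forall fun s =>
      (hh.continuous.comp (by fun_prop : Continuous fun x : ℝ => (s, x))).aestronglyMeasurable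
  · exact (hh.continuous.comp (by fun_prop : Continuous fun x : ℝ => (s₀, x))).intervalIntegrable _ _
  · exact (hcont.comp (by fun_prop : Continuous fun x : ℝ => (s₀, x))).aestronglyMeasurable
  · refine Eventually.of_forall fun x hx s hs => ?_
    exact hC ⟨(s, x), ⟨Metric.ball_subset_closedBall hs, uIoc_subset_uIcc hx⟩, rfl⟩
  · exact intervalIntegrable_const
  · refine Eventually.of_forall fun x _ s _ => ?_
    have h1 : HasFDerivAt h (fderiv ℝ h (s, x)) (s, x) :=
      (hh.differentiable one_ne_zero _).hasFDerivAt
    exact h1.comp s (hasFDerivAt_prodMk_left s x)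

/-- Each directional derivative of the integral is again an integral of a smooth function of the
same kind, so induction on the order of differentiability applies. -/
theorem contDiff_intervalIntegral_param {h : E × ℝ → ℝ} (hh : ContDiff ℝ ∞ h) (a b : ℝ) :
    ContDiff ℝ ∞ (fun s => ∫ x in a..b, h (s, x)) := by
  have key : ∀ n : ℕ, ∀ h : E × ℝ → ℝ, ContDiff ℝ ∞ h →
      ContDiff ℝ n (fun s => ∫ x in a..b, h (s, x)) := by
    intro n
    induction n with
    | zero =>
      intro h hh
      refine contDiff_zero.2 (continuous_iff_continuousAt.2 fun s => ?_)
      exact (hasFDerivAt_intervalIntegral_param (hh.of_le (mod_cast le_top)) a b s).continuousAt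
    | succ n ih =>
      intro h hh
      have hd := fun s => hasFDerivAt_intervalIntegral_param (hh.of_le (mod_cast le_top)) a b s
      push_cast
      rw [contDiff_succ_iff_fderiv_apply]
      refine ⟨fun s => (hd s).differentiableAt, by simp, fun y => ?_⟩
      have : (fun s => fderiv ℝ (fun s => ∫ x in a..b, h (s, x)) s y)
          = fun s => ∫ x in a..b, fderiv ℝ h (s, x) (y, 0) := by
        funext s
        rw [(hd s).fderiv, ContinuousLinearMap.intervalIntegral_apply]
        · rfl
        · refine Continuous.intervalIntegrable ?_ _ _
          exact ((hh.continuous_fderiv (by simp)).comp (by fun_prop : Continuous fun x : ℝ => (s, x))).clm_comp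
            continuous_const
      rw [this]
      exact ih (fun p => fderiv ℝ h p (y, 0)) ((hh.fderiv_right (by simp)).clm_apply contDiff_const)
  exact contDiff_infty.2 fun n => key n h hh

end Parametric

/-! ### Smooth families of functions on the circle -/

/-- A family of smooth functions on the circle depending smoothly on a parameter in `E`. -/
def SmoothFam (E : Type*) [NormedAddCommGroup E] [NormedSpace ℝ E] (γ : E → ℝ → ℝ) : Prop :=
  ContDiff ℝ ∞ (fun p : E × ℝ => γ p.1 p.2) ∧ ∀ s, Function.Periodic (γ s) 1

section Fam

variable {E : Type*} [NormedAddCommGroup E] [NormedSpace ℝ E]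
variable {E' : Type*} [NormedAddCommGroup E'] [NormedSpace ℝ E']
variable {γ η : E → ℝ → ℝ}

theorem IsSmoothPeriodic.fam {f : ℝ → ℝ} (hf : IsSmoothPeriodic f) : SmoothFam E (fun _ => f) :=
  ⟨hf.1.comp contDiff_snd, fun _ => hf.2⟩

theorem SmoothFam.slice (h : SmoothFam E γ) (s : E) : IsSmoothPeriodic (γ s) :=
  ⟨h.1.comp (by fun_prop : ContDiff ℝ ∞ fun x : ℝ => (s, x)), h.2 s⟩

theorem SmoothFam.comp (h : SmoothFam E γ) {e : E' → E} (he : ContDiff ℝ ∞ e) :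
    SmoothFam E' (fun s => γ (e s)) :=
  ⟨h.1.comp (by fun_prop : ContDiff ℝ ∞ fun p : E' × ℝ => (e p.1, p.2)), fun s => h.2 (e s)⟩

theorem SmoothFam.add (h : SmoothFam E γ) (k : SmoothFam E η) :
    SmoothFam E (fun s x => γ s x + η s x) :=
  ⟨h.1.add k.1, fun s x => congrArg₂ (· + ·) (h.2 s x) (k.2 s x)⟩

theorem SmoothFam.sub (h : SmoothFam E γ) (k : SmoothFam E η) :
    SmoothFam E (fun s x => γ s x - η s x) :=
  ⟨h.1.sub k.1, fun s x => congrArg₂ (· - ·) (h.2 s x) (k.2 s x)⟩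

theorem SmoothFam.mul (h : SmoothFam E γ) (k : SmoothFam E η) :
    SmoothFam E (fun s x => γ s x * η s x) :=
  ⟨h.1.mul k.1, fun s x => congrArg₂ (· * ·) (h.2 s x) (k.2 s x)⟩

theorem SmoothFam.of_param {a : E → ℝ} (ha : ContDiff ℝ ∞ a) : SmoothFam E (fun s _ => a s) :=
  ⟨ha.comp contDiff_fst, fun _ _ => rfl⟩

theorem SmoothFam.const (c : ℝ) : SmoothFam E (fun _ _ => c) := .of_param contDiff_const

theorem SmoothFam.neg (h : SmoothFam E γ) : SmoothFam E (fun s x => -γ s x) :=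
  ⟨h.1.neg, fun s x => congrArg (- ·) (h.2 s x)⟩

theorem periodic_deriv {f : ℝ → ℝ} (hf : Function.Periodic f 1) : Function.Periodic (deriv f) 1 :=
  fun x => by rw [← deriv_comp_add_const, funext hf]

theorem SmoothFam.deriv (h : SmoothFam E γ) : SmoothFam E (fun s => deriv (γ s)) := by
  refine ⟨?_, fun s => periodic_deriv (h.2 s)⟩
  have e : (fun p : E × ℝ => _root_.deriv (γ p.1) p.2)
      = fun p => fderiv ℝ (fun p : E × ℝ => γ p.1 p.2) p (0, 1) := by
    funext p
    have h1 : HasFDerivAt (fun p : E × ℝ => γ p.1 p.2) _ (p.1, p.2) :=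
      (h.1.differentiable (by simp) _).hasFDerivAt
    have h2 := h1.comp_hasDerivAt p.2 ((hasDerivAt_const p.2 p.1).prodMk (hasDerivAt_id p.2))
    exact h2.deriv
  rw [e]
  exact (h.1.fderiv_right (by simp)).clm_apply contDiff_const


theorem SmoothFam.param_deriv {γ : E × ℝ → ℝ → ℝ} (h : SmoothFam (E × ℝ) γ) :
    SmoothFam E (fun s x => _root_.deriv (fun ε => γ (s, ε) x) 0) := by
  refine ⟨?_, fun s x => ?_⟩
  · have e : (fun p : E × ℝ => _root_.deriv (fun ε => γ (p.1, ε) p.2) 0)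
        = fun p => fderiv ℝ (fun p : (E × ℝ) × ℝ => γ p.1 p.2) ((p.1, 0), p.2) ((0, 1), 0) := by
      funext p
      have h1 : HasFDerivAt (fun p : (E × ℝ) × ℝ => γ p.1 p.2) _ ((p.1, 0), p.2) :=
        (h.1.differentiable (by simp) _).hasFDerivAt
      have h2 := h1.comp_hasDerivAt (0 : ℝ)
        (((hasDerivAt_const (0 : ℝ) p.1).prodMk (hasDerivAt_id (0 : ℝ))).prodMk
          (hasDerivAt_const (0 : ℝ) p.2))
      exact h2.deriv
    rw [e]
    exact ((h.1.fderiv_right (m := ∞) (by simp)).comp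
      (by fun_prop : ContDiff ℝ ∞ fun p : E × ℝ => ((p.1, (0 : ℝ)), p.2))).clm_apply contDiff_const
  · simp only [h.2 _ x]

theorem SmoothFam.contDiff_mean [FiniteDimensional ℝ E] (h : SmoothFam E γ) :
    ContDiff ℝ ∞ (fun s => mean (γ s)) :=
  contDiff_intervalIntegral_param h.1 0 1

theorem SmoothFam.invD [FiniteDimensional ℝ E] (h : SmoothFam E γ)
    (hper : ∀ s, Function.Periodic (invD (γ s)) 1) : SmoothFam E (fun s => invD (γ s)) := by
  refine ⟨?_, hper⟩
  have hk : ContDiff ℝ ∞ (fun p : E × ℝ => γ p.1 p.2 - mean (γ p.1)) :=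
    h.1.sub (h.contDiff_mean.comp contDiff_fst)
  have hI : ContDiff ℝ ∞ (fun p : E × ℝ => ∫ y in (0 : ℝ)..p.2, (γ p.1 y - mean (γ p.1))) := by
    -- The substitution `y = x θ` moves the variable endpoint into the integrand, so that
    -- differentiation under a fixed integral applies.
    have e : (fun p : E × ℝ => ∫ y in (0 : ℝ)..p.2, (γ p.1 y - mean (γ p.1)))
        = fun p => p.2 * ∫ θ in (0 : ℝ)..1, (γ p.1 (p.2 * θ) - mean (γ p.1)) := by
      funext p
      have := intervalIntegral.mul_integral_comp_mul_left (a := 0) (b := 1)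
        (f := fun y => γ p.1 y - mean (γ p.1)) p.2
      simpa using this.symm
    rw [e]
    refine contDiff_snd.mul (contDiff_intervalIntegral_param (E := E × ℝ)
      (h := fun q => γ q.1.1 (q.1.2 * q.2) - mean (γ q.1.1)) ?_ 0 1)
    exact hk.comp (by fun_prop : ContDiff ℝ ∞ fun q : (E × ℝ) × ℝ => (q.1.1, q.1.2 * q.2))
  exact hI.sub ((contDiff_intervalIntegral_param hI 0 1).comp contDiff_fst)

end Fam

/-! ### Calculus on the circle and the antiderivative of zero mean -/

section Single

variable {f g h : ℝ → ℝ}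

theorem IsSmoothPeriodic.continuous (hf : IsSmoothPeriodic f) : Continuous f := hf.1.continuous

theorem IsSmoothPeriodic.differentiable (hf : IsSmoothPeriodic f) : Differentiable ℝ f :=
  hf.1.differentiable (by simp)

theorem IsSmoothPeriodic.hasDerivAt (hf : IsSmoothPeriodic f) (x : ℝ) :
    HasDerivAt f (deriv f x) x :=
  (hf.differentiable x).hasDerivAt

theorem IsSmoothPeriodic.intervalIntegrable (hf : IsSmoothPeriodic f) (a b : ℝ) :
    IntervalIntegrable f MeasureTheory.volume a b :=
  hf.continuous.intervalIntegrable a b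

theorem IsSmoothPeriodic.const (c : ℝ) : IsSmoothPeriodic (fun _ => c) :=
  ⟨contDiff_const, fun _ => rfl⟩

theorem IsSmoothPeriodic.add (hf : IsSmoothPeriodic f) (hg : IsSmoothPeriodic g) :
    IsSmoothPeriodic (fun x => f x + g x) :=
  (hf.fam.add hg.fam).slice (0 : ℝ)

theorem IsSmoothPeriodic.sub (hf : IsSmoothPeriodic f) (hg : IsSmoothPeriodic g) :
    IsSmoothPeriodic (fun x => f x - g x) :=
  (hf.fam.sub hg.fam).slice (0 : ℝ)

theorem IsSmoothPeriodic.mul (hf : IsSmoothPeriodic f) (hg : IsSmoothPeriodic g) :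
    IsSmoothPeriodic (fun x => f x * g x) :=
  (hf.fam.mul hg.fam).slice (0 : ℝ)

theorem IsSmoothPeriodic.neg (hf : IsSmoothPeriodic f) : IsSmoothPeriodic (fun x => -f x) :=
  hf.fam.neg.slice (0 : ℝ)

theorem IsSmoothPeriodic.const_mul (c : ℝ) (hf : IsSmoothPeriodic f) :
    IsSmoothPeriodic (fun x => c * f x) :=
  (IsSmoothPeriodic.const c).mul hf

theorem IsSmoothPeriodic.deriv (hf : IsSmoothPeriodic f) : IsSmoothPeriodic (deriv f) :=
  hf.fam.deriv.slice (0 : ℝ)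

theorem IsSmoothPeriodic.iteratedDeriv (hf : IsSmoothPeriodic f) (n : ℕ) :
    IsSmoothPeriodic (iteratedDeriv n f) := by
  induction n with
  | zero => rwa [iteratedDeriv_zero]
  | succ n ih => rw [iteratedDeriv_succ]; exact ih.deriv

theorem IsSmoothPeriodic.translate (hf : IsSmoothPeriodic f) (a : ℝ) :
    IsSmoothPeriodic (fun x => f (x + a)) :=
  ⟨hf.1.comp (by fun_prop), fun x => by
    change f (x + 1 + a) = f (x + a); rw [← hf.2 (x + a)]; congr 1; ring⟩

theorem IsSmoothPeriodic.mean_translate (hf : IsSmoothPeriodic f) (a : ℝ) :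
    mean (fun x => f (x + a)) = mean f := by
  unfold mean
  rw [intervalIntegral.integral_comp_add_right, add_comm 1 a, zero_add,
    hf.2.intervalIntegral_add_eq a 0, zero_add]

theorem integral_eq_zero_of_hasDerivAt (hf : IsSmoothPeriodic f) (hg : IsSmoothPeriodic g)
    (h : ∀ x, HasDerivAt f (g x) x) : ∫ x in (0 : ℝ)..1, g x = 0 := by
  rw [intervalIntegral.integral_eq_sub_of_hasDerivAt (fun x _ => h x) (hg.intervalIntegrable _ _)]
  have := hf.2 0
  rw [zero_add] at this
  rw [this, sub_self]

theorem IsSmoothPeriodic.mean_deriv (hf : IsSmoothPeriodic f) : mean (_root_.deriv f) = 0 :=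
  integral_eq_zero_of_hasDerivAt hf hf.deriv hf.hasDerivAt

theorem IsSmoothPeriodic.integral_mul_deriv (hf : IsSmoothPeriodic f) (hg : IsSmoothPeriodic g) :
    ∫ x in (0 : ℝ)..1, f x * _root_.deriv g x = -∫ x in (0 : ℝ)..1, _root_.deriv f x * g x := by
  have h := integral_eq_zero_of_hasDerivAt (hf.mul hg) ((hf.deriv.mul hg).add (hf.mul hg.deriv))
    fun x => (hf.hasDerivAt x).mul (hg.hasDerivAt x)
  rw [intervalIntegral.integral_add ((hf.deriv.mul hg).intervalIntegrable _ _)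
    ((hf.mul hg.deriv).intervalIntegrable _ _)] at h
  linarith

theorem mean_add (hf : IsSmoothPeriodic f) (hg : IsSmoothPeriodic g) :
    mean (fun x => f x + g x) = mean f + mean g :=
  intervalIntegral.integral_add (hf.intervalIntegrable _ _) (hg.intervalIntegrable _ _)

theorem mean_sub (hf : IsSmoothPeriodic f) (hg : IsSmoothPeriodic g) :
    mean (fun x => f x - g x) = mean f - mean g :=
  intervalIntegral.integral_sub (hf.intervalIntegrable _ _) (hg.intervalIntegrable _ _)

theorem mean_const_mul (c : ℝ) (f : ℝ → ℝ) : mean (fun x => c * f x) = c * mean f :=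
  intervalIntegral.integral_const_mul c f

theorem mean_const (c : ℝ) : mean (fun _ => c) = c := by simp [mean]

theorem IsSmoothPeriodic.invD_hasDerivAt (hf : IsSmoothPeriodic f) (x : ℝ) :
    HasDerivAt (invD f) (f x - mean f) x := by
  have hc : Continuous fun y => f y - mean f := hf.continuous.sub continuous_const
  exact (hc.integral_hasStrictDerivAt 0 x).hasDerivAt.sub_const _

theorem IsSmoothPeriodic.deriv_invD (hf : IsSmoothPeriodic f) :
    _root_.deriv (invD f) = fun x => f x - mean f :=
  funext fun x => (hf.invD_hasDerivAt x).deriv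

theorem IsSmoothPeriodic.periodic_invD (hf : IsSmoothPeriodic f) :
    Function.Periodic (invD f) 1 := by
  intro x
  have hc := hf.sub (IsSmoothPeriodic.const (mean f))
  have h0 : ∫ y in x..(x + 1), (f y - mean f) = 0 := by
    rw [hc.2.intervalIntegral_add_eq x 0, zero_add]
    have := mean_sub hf (IsSmoothPeriodic.const (mean f))
    rwa [mean_const, sub_self] at this
  unfold MuBurgers.invD
  rw [← intervalIntegral.integral_add_adjacent_intervals (hc.intervalIntegrable 0 x)
    (hc.intervalIntegrable x (x + 1)), h0, add_zero]

theorem SmoothFam.invD' {E : Type*} [NormedAddCommGroup E] [NormedSpace ℝ E]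
    [FiniteDimensional ℝ E] {γ : E → ℝ → ℝ} (h : SmoothFam E γ) :
    SmoothFam E (fun s => MuBurgers.invD (γ s)) :=
  h.invD fun s => (h.slice s).periodic_invD

theorem IsSmoothPeriodic.invD (hf : IsSmoothPeriodic f) : IsSmoothPeriodic (invD f) :=
  hf.fam.invD'.slice (0 : ℝ)

theorem IsSmoothPeriodic.mean_invD (hf : IsSmoothPeriodic f) : mean (MuBurgers.invD f) = 0 := by
  have hc : Continuous fun x => ∫ y in (0 : ℝ)..x, (f y - mean f) :=
    intervalIntegral.continuous_primitive
      (fun a b => (hf.sub (IsSmoothPeriodic.const (mean f))).intervalIntegrable a b) 0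
  unfold MuBurgers.invD
  rw [mean, intervalIntegral.integral_sub (hc.intervalIntegrable _ _) intervalIntegrable_const]
  simp [mean]

/-- Two antiderivatives differ by a constant, and the zero mean fixes it. Later identities for
`invD` are reduced to this criterion. -/
theorem IsSmoothPeriodic.invD_unique {w : ℝ → ℝ} (hf : IsSmoothPeriodic f)
    (hw : ∀ x, HasDerivAt w (f x - mean f) x) (hm : mean w = 0) : w = MuBurgers.invD f := by
  have hd : ∀ x, HasDerivAt (fun x => w x - MuBurgers.invD f x) 0 x := fun x => by
    have := (hw x).sub (hf.invD_hasDerivAt x)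
    rwa [sub_self] at this
  have hconst : ∀ x, w x - MuBurgers.invD f x = w 0 - MuBurgers.invD f 0 := fun x =>
    is_const_of_deriv_eq_zero (fun x => (hd x).differentiableAt) (fun x => (hd x).deriv) x 0
  have hwc : Continuous w := continuous_iff_continuousAt.2 fun x => (hw x).continuousAt
  have h2 : mean (fun x => w x - MuBurgers.invD f x) = 0 := by
    rw [mean, intervalIntegral.integral_sub (hwc.intervalIntegrable _ _)
      (hf.invD.intervalIntegrable _ _)]
    change mean w - mean (MuBurgers.invD f) = 0
    rw [hm, hf.mean_invD, sub_self]
  rw [funext hconst, mean_const] at h2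
  funext x
  have := hconst x
  linarith

theorem invD_add_const_mul (hf : IsSmoothPeriodic f) (hg : IsSmoothPeriodic g) (c : ℝ) :
    invD (fun x => f x + c * g x) = fun x => invD f x + c * invD g x := by
  symm
  apply (hf.add (hg.const_mul c)).invD_unique
  · intro x
    rw [mean_add hf (hg.const_mul c), mean_const_mul]
    exact ((hf.invD_hasDerivAt x).add ((hg.invD_hasDerivAt x).const_mul c)).congr_deriv (by ring)
  · rw [mean_add hf.invD (hg.invD.const_mul c), mean_const_mul, hf.mean_invD, hg.mean_invD]
    simp

theorem invD_translate (hf : IsSmoothPeriodic f) (a : ℝ) :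
    invD (fun x => f (x + a)) = fun x => invD f (x + a) := by
  symm
  apply (hf.translate a).invD_unique
  · intro x
    rw [hf.mean_translate]
    exact (hf.invD_hasDerivAt (x + a)).comp_add_const x a
  · rw [hf.invD.mean_translate, hf.mean_invD]

theorem integral_mul_invD (hf : IsSmoothPeriodic f) (hg : IsSmoothPeriodic g) :
    ∫ x in (0 : ℝ)..1, f x * invD g x = -∫ x in (0 : ℝ)..1, invD f x * g x := by
  have h := hf.invD.integral_mul_deriv hg.invD
  rw [hf.deriv_invD, hg.deriv_invD] at h
  have e1 : ∫ x in (0 : ℝ)..1, invD f x * (g x - mean g) = ∫ x in (0 : ℝ)..1, invD f x * g x := by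
    simp_rw [mul_sub]
    rw [intervalIntegral.integral_sub ((hf.invD.mul hg).intervalIntegrable _ _)
      ((hf.invD.mul (IsSmoothPeriodic.const _)).intervalIntegrable _ _),
      intervalIntegral.integral_mul_const]
    change _ - mean (invD f) * _ = _
    rw [hf.mean_invD]; simp
  have e2 : ∫ x in (0 : ℝ)..1, (f x - mean f) * invD g x = ∫ x in (0 : ℝ)..1, f x * invD g x := by
    simp_rw [sub_mul]
    rw [intervalIntegral.integral_sub ((hf.mul hg.invD).intervalIntegrable _ _)
      (((IsSmoothPeriodic.const _).mul hg.invD).intervalIntegrable _ _),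
      intervalIntegral.integral_const_mul]
    change _ - _ * mean (invD g) = _
    rw [hg.mean_invD]; simp
  rw [e1, e2] at h
  linarith

end Single

/-! ### First variation of one-parameter families -/

theorem hasDerivAt_intervalIntegral_param {h : ℝ × ℝ → ℝ} (hh : ContDiff ℝ ∞ h) (a b s₀ : ℝ) :
    HasDerivAt (fun s => ∫ x in a..b, h (s, x))
      (∫ x in a..b, deriv (fun s => h (s, x)) s₀) s₀ := by
  have h1 := (hasFDerivAt_intervalIntegral_param (hh.of_le (mod_cast le_top)) a b s₀).hasDerivAt
  rw [ContinuousLinearMap.intervalIntegral_apply] at h1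
  · refine h1.congr_deriv (intervalIntegral.integral_congr fun x _ => ?_)
    have h2 : HasFDerivAt h (fderiv ℝ h (s₀, x)) (s₀, x) :=
      (hh.differentiable (by simp) _).hasFDerivAt
    exact (h2.comp s₀ (hasFDerivAt_prodMk_left s₀ x)).hasDerivAt.deriv.symm
  · refine Continuous.intervalIntegrable ?_ _ _
    exact ((hh.continuous_fderiv (by simp)).comp
      (by fun_prop : Continuous fun x : ℝ => (s₀, x))).clm_comp continuous_const

theorem ContDiff.deriv_snd_zero {P : ℝ × ℝ → ℝ} (hP : ContDiff ℝ ∞ P) :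
    Continuous fun s => deriv (fun t => P (s, t)) 0 := by
  have e : (fun s => deriv (fun t => P (s, t)) 0) = fun s => fderiv ℝ P (s, 0) (0, 1) := by
    funext s
    have h1 : HasFDerivAt P (fderiv ℝ P (s, 0)) (s, 0) :=
      (hP.differentiable (by simp) _).hasFDerivAt
    exact (h1.comp_hasDerivAt (0 : ℝ)
      ((hasDerivAt_const (0 : ℝ) s).prodMk (hasDerivAt_id (0 : ℝ)))).deriv
  rw [e]
  exact ((hP.continuous_fderiv (by simp)).comp
    (by fun_prop : Continuous fun s : ℝ => (s, (0 : ℝ)))).clm_apply continuous_const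

/-- Interchange of the partial derivatives of a function of two real variables. -/
theorem hasDerivAt_partial_comm {φ : ℝ → ℝ → ℝ} {P : ℝ × ℝ → ℝ} {Q : ℝ → ℝ}
    (hP : ContDiff ℝ ∞ P) (hφ : ∀ s t, HasDerivAt (fun s => φ s t) (P (s, t)) s)
    (hQ : ∀ s, HasDerivAt (fun t => φ s t) (Q s) 0) (s : ℝ) :
    HasDerivAt Q (deriv (fun t => P (s, t)) 0) s := by
  -- No joint regularity of `φ` is available, as it will be a functional evaluated on a plane of
  -- functions. Integrating its smooth `s`-derivative and differentiating that integral in `t`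
  -- replaces the usual symmetry theorem.
  have h1 : ∀ s t, φ s t - φ 0 t = ∫ σ in (0 : ℝ)..s, P (σ, t) := fun s t => by
    rw [intervalIntegral.integral_eq_sub_of_hasDerivAt (fun σ _ => hφ σ t)]
    exact (hP.continuous.comp (by fun_prop : Continuous fun σ : ℝ => (σ, t))).intervalIntegrable _ _
  have h2 : ∀ s, Q s = Q 0 + ∫ σ in (0 : ℝ)..s, deriv (fun t => P (σ, t)) 0 := fun s => by
    have h3 := hasDerivAt_intervalIntegral_param (h := fun p => P (p.2, p.1))
      (hP.comp (contDiff_snd.prodMk contDiff_fst)) 0 s 0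
    have h4 := (hQ s).sub (hQ 0)
    have e : ((fun t => φ s t) - fun t => φ 0 t) = fun t => ∫ σ in (0 : ℝ)..s, P (σ, t) :=
      funext fun t => h1 s t
    rw [e] at h4
    rw [← h4.unique h3]; ring
  rw [funext h2]
  exact ((ContDiff.deriv_snd_zero hP).integral_hasStrictDerivAt 0 s).hasDerivAt.const_add _

/-- The one-parameter family `γ` is smooth, and its parameter derivative at `0` is `γ'`. -/
def HasDot (γ : ℝ → ℝ → ℝ) (γ' : ℝ → ℝ) : Prop :=
  SmoothFam ℝ γ ∧ ∀ x, HasDerivAt (fun ε => γ ε x) (γ' x) 0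

section Dot

variable {γ η : ℝ → ℝ → ℝ} {γ' η' : ℝ → ℝ}

theorem SmoothFam.hasDot (h : SmoothFam ℝ γ) : HasDot γ (fun x => _root_.deriv (fun ε => γ ε x) 0) :=
  ⟨h, fun x => ((h.1.comp (by fun_prop : ContDiff ℝ ∞ fun ε : ℝ => (ε, x))).differentiable
    (by simp) 0).hasDerivAt⟩

theorem HasDot.unique (h : HasDot γ γ') (k : HasDot γ η') : γ' = η' :=
  funext fun x => (h.2 x).unique (k.2 x)

theorem HasDot.isSmoothPeriodic (h : HasDot γ γ') : IsSmoothPeriodic γ' := by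
  rw [h.unique h.1.hasDot]
  exact (SmoothFam.param_deriv (E := ℝ) (γ := fun p => γ p.2) (h.1.comp contDiff_snd)).slice 0

theorem HasDot.const {f : ℝ → ℝ} (hf : IsSmoothPeriodic f) : HasDot (fun _ => f) (fun _ => 0) :=
  ⟨hf.fam, fun _ => hasDerivAt_const _ _⟩

theorem HasDot.add (h : HasDot γ γ') (k : HasDot η η') :
    HasDot (fun ε x => γ ε x + η ε x) (fun x => γ' x + η' x) :=
  ⟨h.1.add k.1, fun x => (h.2 x).add (k.2 x)⟩

theorem HasDot.sub (h : HasDot γ γ') (k : HasDot η η') :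
    HasDot (fun ε x => γ ε x - η ε x) (fun x => γ' x - η' x) :=
  ⟨h.1.sub k.1, fun x => (h.2 x).sub (k.2 x)⟩

theorem HasDot.neg (h : HasDot γ γ') : HasDot (fun ε x => -γ ε x) (fun x => -γ' x) :=
  ⟨h.1.neg, fun x => (h.2 x).neg⟩

theorem HasDot.mul (h : HasDot γ γ') (k : HasDot η η') :
    HasDot (fun ε x => γ ε x * η ε x) (fun x => γ' x * η 0 x + γ 0 x * η' x) :=
  ⟨h.1.mul k.1, fun x => (h.2 x).mul (k.2 x)⟩

theorem HasDot.const_mul (c : ℝ) (h : HasDot γ γ') :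
    HasDot (fun ε x => c * γ ε x) (fun x => c * γ' x) :=
  ⟨(SmoothFam.const c).mul h.1, fun x => (h.2 x).const_mul c⟩

theorem HasDot.mean (h : HasDot γ γ') : HasDerivAt (fun ε => mean (γ ε)) (mean γ') 0 := by
  rw [h.unique h.1.hasDot]
  exact hasDerivAt_intervalIntegral_param h.1.1 0 1 0

theorem HasDot.deriv (h : HasDot γ γ') : HasDot (fun ε => deriv (γ ε)) (deriv γ') := by
  refine ⟨h.1.deriv, fun x => ?_⟩
  have hP : ContDiff ℝ ∞ fun p : ℝ × ℝ => _root_.deriv (γ p.2) p.1 :=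
    h.1.deriv.1.comp (contDiff_snd.prodMk contDiff_fst)
  have h1 := hasDerivAt_partial_comm (φ := fun x ε => γ ε x) (Q := γ') hP
    (fun x ε => (h.1.slice ε).hasDerivAt x) h.2 x
  rw [h1.deriv]
  exact h.1.deriv.hasDot.2 x

theorem HasDot.iteratedDeriv (h : HasDot γ γ') (n : ℕ) :
    HasDot (fun ε => iteratedDeriv n (γ ε)) (iteratedDeriv n γ') := by
  induction n with
  | zero => simpa only [iteratedDeriv_zero] using h
  | succ n ih => simpa only [iteratedDeriv_succ] using ih.deriv

/-- The variation of `invD (γ ε)` has derivative `γ' - mean γ'` and zero mean, so uniqueness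
identifies it with `invD γ'`. -/
theorem HasDot.invD (h : HasDot γ γ') : HasDot (fun ε => invD (γ ε)) (invD γ') := by
  have h1 := h.1.invD'.hasDot
  set δ : ℝ → ℝ := fun x => _root_.deriv (fun ε => MuBurgers.invD (γ ε) x) 0 with hδ
  have h2 : HasDot (fun ε => _root_.deriv (MuBurgers.invD (γ ε))) (fun x => γ' x - MuBurgers.mean γ') := by
    have e : (fun ε => _root_.deriv (MuBurgers.invD (γ ε))) = fun ε x => γ ε x - MuBurgers.mean (γ ε) :=
      funext fun ε => (h.1.slice ε).deriv_invD
    rw [e]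
    exact h.sub ⟨.of_param h.1.contDiff_mean, fun _ => h.mean⟩
  have h3 : δ = MuBurgers.invD γ' := by
    apply h.isSmoothPeriodic.invD_unique
    · intro x
      have := h1.isSmoothPeriodic.hasDerivAt x
      rwa [h1.deriv.unique h2] at this
    · have h4 := h1.mean
      simp only [fun ε => (h.1.slice ε).mean_invD] at h4
      exact h4.unique (hasDerivAt_const _ _)
  rwa [h3] at h1

end Dot

theorem HasDot.line {m v : ℝ → ℝ} (hm : IsSmoothPeriodic m) (hv : IsSmoothPeriodic v) :
    HasDot (fun ε x => m x + ε * v x) v :=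
  ⟨hm.fam.add ((SmoothFam.of_param contDiff_id).mul hv.fam), fun x => by
    simpa using ((hasDerivAt_id (0 : ℝ)).mul_const (v x)).const_add (m x)⟩

/-! ### Gradients of functionals: Hessian symmetry and translation invariance -/

/-- The derivative of the map `f` at `m` in the direction `v`. -/
noncomputable def dirDeriv (f : (ℝ → ℝ) → ℝ → ℝ) (m v : ℝ → ℝ) : ℝ → ℝ :=
  fun x => deriv (fun ε : ℝ => f (fun y => m y + ε * v y) x) 0

namespace IsFunctional

variable {F : (ℝ → ℝ) → ℝ} {f : (ℝ → ℝ) → ℝ → ℝ}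

/-- A linear isomorphism with `Fin k → ℝ` carries the smoothness hypothesis over to any
finite-dimensional parameter space, such as products with an extra variation parameter. -/
theorem fam {E : Type*} [NormedAddCommGroup E] [NormedSpace ℝ E] [FiniteDimensional ℝ E]
    (hF : IsFunctional F f) {γ : E → ℝ → ℝ} (h : SmoothFam E γ) :
    SmoothFam E (fun s => f (γ s)) := by
  let e : E ≃L[ℝ] (Fin (Module.finrank ℝ E) → ℝ) :=
    ContinuousLinearEquiv.ofFinrankEq (by simp)
  have h1 : SmoothFam _ (fun s => f (γ (e.symm s))) := hF.smooth _ (fun s => γ (e.symm s)) (h.comp e.symm.contDiff)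
  have h2 := h1.comp e.contDiff
  simpa using h2

variable {m v w : ℝ → ℝ}

theorem isSmoothPeriodic (hF : IsFunctional F f) (hm : IsSmoothPeriodic m) :
    IsSmoothPeriodic (f m) :=
  (hF.fam (hm.fam (E := ℝ))).slice 0

theorem hasDot (hF : IsFunctional F f) (hm : IsSmoothPeriodic m) (hv : IsSmoothPeriodic v) :
    HasDot (fun ε => f (fun y => m y + ε * v y)) (dirDeriv f m v) :=
  (hF.fam (HasDot.line hm hv).1).hasDot

theorem dirDeriv_fam {E : Type*} [NormedAddCommGroup E] [NormedSpace ℝ E] [FiniteDimensional ℝ E]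
    (hF : IsFunctional F f) {γ η : E → ℝ → ℝ} (h : SmoothFam E γ) (k : SmoothFam E η) :
    SmoothFam E (fun s => dirDeriv f (γ s) (η s)) :=
  SmoothFam.param_deriv (γ := fun p : E × ℝ => f (fun y => γ p.1 y + p.2 * η p.1 y))
    (hF.fam ((h.comp contDiff_fst).add
      ((SmoothFam.of_param contDiff_snd).mul (k.comp contDiff_fst))))

theorem hasDerivAt_line (hF : IsFunctional F f) (hm : IsSmoothPeriodic m)
    (hv : IsSmoothPeriodic v) (s : ℝ) :
    HasDerivAt (fun s => F (fun x => m x + s * v x))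
      (mean (fun x => f (fun y => m y + s * v y) x * v x)) s := by
  have h := hF.variation _ v ((HasDot.line hm hv).1.slice s) hv
  change HasDerivAt _ (mean fun x => f (fun y => m y + s * v y) x * v x) 0 at h
  generalize (mean fun x => f (fun y => m y + s * v y) x * v x) = d at h ⊢
  rw [← sub_self s] at h
  have h1 := h.comp_sub_const s s
  have e : (fun s' : ℝ => F fun x => m x + s * v x + (s' - s) * v x)
      = fun s => F fun x => m x + s * v x := by
    funext s'; congr 1; funext x; ring
  rwa [e] at h1

/-- The Hessian of `F` is symmetric: both sides are mixed partial derivatives of `F(m + s v + t w)`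
at the origin. -/
theorem dirDeriv_symm (hF : IsFunctional F f) (hm : IsSmoothPeriodic m)
    (hv : IsSmoothPeriodic v) (hw : IsSmoothPeriodic w) :
    mean (fun x => dirDeriv f m v x * w x) = mean (fun x => dirDeriv f m w x * v x) := by
  have hfam : SmoothFam (ℝ × ℝ) (fun p x => m x + p.1 * v x + p.2 * w x) :=
    (hm.fam.add ((SmoothFam.of_param contDiff_fst).mul hv.fam)).add
      ((SmoothFam.of_param contDiff_snd).mul hw.fam)
  have h1 := hasDerivAt_partial_comm
    (φ := fun s t => F (fun x => m x + s * v x + t * w x))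
    (P := fun p => mean (fun x => f (fun y => m y + p.1 * v y + p.2 * w y) x * v x))
    (Q := fun s => mean (fun x => f (fun y => m y + s * v y) x * w x))
    ((hF.fam hfam).mul hv.fam).contDiff_mean ?_ ?_ 0
  · have h2 := ((hF.hasDot hm hv).mul (HasDot.const hw)).mean
    have h3 := ((hF.hasDot hm hw).mul (HasDot.const hv)).mean
    simp only [mul_zero, add_zero] at h2 h3
    rw [h2.unique h1]
    simpa using h3.deriv
  · intro s t
    have := hF.hasDerivAt_line (hm.add (hw.const_mul t)) hv s
    have e : ∀ s : ℝ, (fun x => m x + t * w x + s * v x) = fun x => m x + s * v x + t * w x :=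
      fun s => funext fun x => by ring
    simpa only [e] using this
  · intro s
    simpa using hF.hasDerivAt_line (hm.add (hv.const_mul s)) hw 0

/-- Infinitesimal translation invariance. -/
theorem mean_mul_deriv (hF : IsFunctional F f) (hm : IsSmoothPeriodic m) :
    mean (fun x => f m x * deriv m x) = 0 := by
  have htr : SmoothFam ℝ (fun a x => m (x + a)) :=
    ⟨hm.1.comp (by fun_prop), fun a => (hm.translate a).2⟩
  -- The variational derivative controls `F` only along straight lines, and translates of `m` do not
  -- form one. So `m` is joined to `m(· + a)` by a segment, with `θ` as its parameter. The integral
  -- of the derivative over `θ` vanishes for every `a` by invariance, and its `a`-derivative at `0`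
  -- is the required mean.
  have hΔ : SmoothFam ℝ (fun a x => m (x + a) - m x) := htr.sub hm.fam
  have hfam : SmoothFam (ℝ × ℝ) (fun p x => m x + p.2 * (m (x + p.1) - m x)) :=
    hm.fam.add ((SmoothFam.of_param contDiff_snd).mul (hΔ.comp contDiff_fst))
  let P : ℝ × ℝ → ℝ := fun p =>
    mean (fun x => f (fun y => m y + p.2 * (m (y + p.1) - m y)) x * (m (x + p.1) - m x))
  have hP : ContDiff ℝ ∞ P := ((hF.fam hfam).mul (hΔ.comp contDiff_fst)).contDiff_mean
  have h0 : ∀ a, ∫ θ in (0 : ℝ)..1, P (a, θ) = 0 := fun a => by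
    rw [intervalIntegral.integral_eq_sub_of_hasDerivAt
      (fun θ _ => hF.hasDerivAt_line hm (hΔ.slice a) θ)]
    · simp [hF.translation m hm a]
    · exact (hP.continuous.comp (by fun_prop : Continuous fun θ : ℝ => (a, θ))).intervalIntegrable _ _
  have h1 := hasDerivAt_intervalIntegral_param hP 0 1 0
  simp only [h0] at h1
  have h2 := h1.unique (hasDerivAt_const _ _)
  have h3 : ∀ θ : ℝ, deriv (fun a => P (a, θ)) 0 = mean (fun x => f m x * deriv m x) := fun θ => by
    have hf := (hF.fam (hfam.comp (by fun_prop : ContDiff ℝ ∞ fun a : ℝ => (a, θ)))).hasDot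
    have hd : HasDot (fun a x => m (x + a) - m x) (deriv m) := ⟨hΔ, fun x => by
      have := (hm.hasDerivAt (x + 0)).comp_const_add x 0
      simpa using this.sub_const (m x)⟩
    have := (hf.mul hd).mean
    simp only [add_zero, sub_self, mul_zero, zero_add] at this
    exact this.deriv
  simpa [h3] using h2

theorem equivariant (hF : IsFunctional F f) (hm : IsSmoothPeriodic m) (a : ℝ) :
    f (fun x => m (x + a)) = fun x => f m (x + a) := by
  have hfa := hF.isSmoothPeriodic (hm.translate a)
  have hfm := (hF.isSmoothPeriodic hm).translate a
  have key : ∀ v, IsSmoothPeriodic v →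
      mean (fun x => f (fun x => m (x + a)) x * v x) = mean (fun x => f m (x + a) * v x) := by
    intro v hv
    have h1 := hF.variation _ v (hm.translate a) hv
    have h2 := hF.variation m _ hm (hv.translate (-a))
    have e : (fun ε : ℝ => F fun x => m (x + a) + ε * v x)
        = fun ε => F fun x => m x + ε * v (x + -a) := by
      funext ε
      rw [← hF.translation _ (hm.add ((hv.translate (-a)).const_mul ε)) a]
      simp
    rw [e] at h1
    have h3 := ((hF.isSmoothPeriodic hm).mul (hv.translate (-a))).mean_translate a
    simp only [add_neg_cancel_right] at h3
    exact (h1.unique h2).trans h3.symm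
  -- Both gradients pair equally with every test function. Testing with their own difference gives a
  -- vanishing integral of a continuous square.
  have hd := hfa.sub hfm
  have h1 := key _ hd
  have h2 : ∫ x in (0 : ℝ)..1, (f (fun x => m (x + a)) x - f m (x + a)) ^ 2 = 0 := by
    have h3 := mean_sub (hfa.mul hd) (hfm.mul hd)
    rw [h1, sub_self] at h3
    refine Eq.trans (intervalIntegral.integral_congr fun x _ => ?_) h3
    ring
  funext x
  by_contra hne
  have hper : Function.Periodic (fun x => (f (fun x => m (x + a)) x - f m (x + a)) ^ 2) 1 :=
    fun x => congrArg (· ^ 2) (hd.2 x)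
  have h3 := hper.intervalIntegral_add_eq 0 x
  rw [zero_add, h2] at h3
  refine h3.not_lt (intervalIntegral.integral_pos (by linarith) (hd.continuous.pow 2).continuousOn
    (fun y _ => sq_nonneg _) ⟨x, ⟨le_rfl, by linarith⟩, ?_⟩)
  have := sub_ne_zero.2 hne
  positivity

end IsFunctional

/-! ### Adjointness, skewness and equivariance of the operator pencil -/

/-- The `L²` pairing of functions on the circle. -/
noncomputable def pairing (f g : ℝ → ℝ) : ℝ := mean (fun x => f x * g x)

section Pairing

variable {f g h m v : ℝ → ℝ}

theorem pairing_comm (f g : ℝ → ℝ) : pairing f g = pairing g f := by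
  unfold pairing; simp only [mul_comm]

theorem pairing_add_right (hf : IsSmoothPeriodic f) (hg : IsSmoothPeriodic g)
    (hh : IsSmoothPeriodic h) :
    pairing f (fun x => g x + h x) = pairing f g + pairing f h := by
  unfold pairing; simp only [mul_add]; exact mean_add (hf.mul hg) (hf.mul hh)

theorem pairing_const_mul_right (c : ℝ) (f g : ℝ → ℝ) :
    pairing f (fun x => c * g x) = c * pairing f g := by
  unfold pairing; rw [← mean_const_mul]; congr 1; funext x; ring

theorem pairing_neg_right (f g : ℝ → ℝ) : pairing f (fun x => -g x) = -pairing f g := by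
  have := pairing_const_mul_right (-1) f g
  simpa using this

theorem pairing_sub_right (hf : IsSmoothPeriodic f) (hg : IsSmoothPeriodic g)
    (hh : IsSmoothPeriodic h) :
    pairing f (fun x => g x - h x) = pairing f g - pairing f h := by
  unfold pairing; simp only [mul_sub]; exact mean_sub (hf.mul hg) (hf.mul hh)

theorem pairing_invD (hf : IsSmoothPeriodic f) (hg : IsSmoothPeriodic g) :
    pairing f (invD g) = -pairing (invD f) g := integral_mul_invD hf hg

theorem pairing_deriv (hf : IsSmoothPeriodic f) (hg : IsSmoothPeriodic g) :
    pairing f (deriv g) = -pairing (deriv f) g := hf.integral_mul_deriv hg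

theorem IsSmoothPeriodic.invD3 (hf : IsSmoothPeriodic f) : IsSmoothPeriodic (MuBurgers.invD^[3] f) :=
  hf.invD.invD.invD

theorem pairing_invD3 (hf : IsSmoothPeriodic f) (hg : IsSmoothPeriodic g) :
    pairing f (invD^[3] g) = -pairing (invD^[3] f) g := by
  change pairing f (invD (invD (invD g))) = -pairing (invD (invD (invD f))) g
  rw [pairing_invD hf hg.invD.invD, pairing_invD hf.invD hg.invD, pairing_invD hf.invD.invD hg]
  ring

theorem pairing_iteratedDeriv (n : ℕ) (hf : IsSmoothPeriodic f) (hg : IsSmoothPeriodic g) :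
    pairing f (iteratedDeriv n g) = (-1) ^ n * pairing (iteratedDeriv n f) g := by
  induction n generalizing f with
  | zero => simp
  | succ n ih =>
    rw [iteratedDeriv_succ, pairing_deriv hf (hg.iteratedDeriv n), ih hf.deriv,
      ← iteratedDeriv_succ', pow_succ]
    ring

theorem IsSmoothPeriodic.outerOp (hm : IsSmoothPeriodic m) (hf : IsSmoothPeriodic f) :
    IsSmoothPeriodic (outerOp m f) :=
  (hm.mul hf.deriv).add ((hm.deriv.const_mul (1 / 3)).mul hf)

theorem IsSmoothPeriodic.innerOp (hm : IsSmoothPeriodic m) (hf : IsSmoothPeriodic f) :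
    IsSmoothPeriodic (innerOp m f) :=
  (hm.mul hf.deriv).add ((hm.deriv.const_mul (2 / 3)).mul hf)

theorem mean_eq_zero_of_hasDerivAt {W w : ℝ → ℝ} (hW : ∀ x, HasDerivAt W (w x) x)
    (hw : Continuous w) (hper : W 1 = W 0) : mean w = 0 := by
  rw [mean, intervalIntegral.integral_eq_sub_of_hasDerivAt (fun x _ => hW x)
    (hw.intervalIntegrable _ _), hper, sub_self]

/-- `f · outerOp m g + innerOp m f · g` is the derivative of `m f g`; this is why the weights 1/3
and 2/3 add up to one. -/
theorem pairing_outerOp (hm : IsSmoothPeriodic m) (hf : IsSmoothPeriodic f)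
    (hg : IsSmoothPeriodic g) : pairing f (outerOp m g) = -pairing (innerOp m f) g := by
  have hW := hm.mul (hf.mul hg)
  have h1 := hW.mean_deriv
  have h2 : deriv (fun x => m x * (f x * g x))
      = fun x => f x * outerOp m g x + innerOp m f x * g x := by
    funext x
    have := (hm.hasDerivAt x).mul ((hf.hasDerivAt x).mul (hg.hasDerivAt x))
    refine this.deriv.trans ?_
    simp only [outerOp, innerOp, Pi.mul_apply]
    ring
  rw [h2, mean_add (hf.mul (hm.outerOp hg)) ((hm.innerOp hf).mul hg)] at h1
  unfold pairing
  linarith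

theorem outerOp_add_const_mul (m : ℝ → ℝ) (hf : IsSmoothPeriodic f) (hg : IsSmoothPeriodic g)
    (c : ℝ) : outerOp m (fun y => f y + c * g y) = fun x => outerOp m f x + c * outerOp m g x := by
  funext x
  have h := ((hf.hasDerivAt x).add ((hg.hasDerivAt x).const_mul c)).deriv
  simp only [outerOp]
  erw [h]
  ring

theorem innerOp_add_const_mul (m : ℝ → ℝ) (hf : IsSmoothPeriodic f) (hg : IsSmoothPeriodic g)
    (c : ℝ) : innerOp m (fun y => f y + c * g y) = fun x => innerOp m f x + c * innerOp m g x := by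
  funext x
  have h := ((hf.hasDerivAt x).add ((hg.hasDerivAt x).const_mul c)).deriv
  simp only [innerOp]
  erw [h]
  ring

theorem invD3_add_const_mul (hf : IsSmoothPeriodic f) (hg : IsSmoothPeriodic g) (c : ℝ) :
    invD^[3] (fun x => f x + c * g x) = fun x => invD^[3] f x + c * invD^[3] g x := by
  change invD (invD (invD _)) = fun x => invD (invD (invD f)) x + c * invD (invD (invD g)) x
  rw [invD_add_const_mul hf hg, invD_add_const_mul hf.invD hg.invD,
    invD_add_const_mul hf.invD.invD hg.invD.invD]

theorem J0_zero (m f : ℝ → ℝ) : J0 0 m f = fun x => -outerOp m (invD^[3] (innerOp m f)) x := by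
  unfold J0; simp only [add_zero]

theorem IsSmoothPeriodic.J0 (κ : ℝ) (hm : IsSmoothPeriodic m) (hf : IsSmoothPeriodic f) :
    IsSmoothPeriodic (J0 κ m f) :=
  (hm.outerOp ((hm.innerOp hf).invD3.add (IsSmoothPeriodic.const κ))).neg

theorem pairing_J0_zero (hm : IsSmoothPeriodic m) (hf : IsSmoothPeriodic f)
    (hg : IsSmoothPeriodic g) :
    pairing f (J0 0 m g) = pairing (innerOp m f) (invD^[3] (innerOp m g)) := by
  rw [J0_zero, pairing_neg_right, pairing_outerOp hm hf (hm.innerOp hg).invD3, neg_neg]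

/-- The pencil `a J₀ + b J₂`. -/
noncomputable def pencil (a b : ℝ) (m f : ℝ → ℝ) : ℝ → ℝ :=
  fun x => a * J0 0 m f x + b * J2 m f x

theorem IsSmoothPeriodic.pencil (a b : ℝ) (hm : IsSmoothPeriodic m) (hf : IsSmoothPeriodic f) :
    IsSmoothPeriodic (pencil a b m f) :=
  ((hm.J0 0 hf).const_mul a).add ((hf.iteratedDeriv 5).const_mul b)

theorem pairing_pencil (a b : ℝ) (hm : IsSmoothPeriodic m) (hf : IsSmoothPeriodic f)
    (hg : IsSmoothPeriodic g) :
    pairing f (MuBurgers.pencil a b m g) = a * pairing f (J0 0 m g) + b * pairing f (J2 m g) := by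
  have h5 : IsSmoothPeriodic (J2 m g) := hg.iteratedDeriv 5
  unfold MuBurgers.pencil
  rw [pairing_add_right hf ((hm.J0 0 hg).const_mul a) (h5.const_mul b),
    pairing_const_mul_right, pairing_const_mul_right]

theorem pairing_pencil_skew (a b : ℝ) (hm : IsSmoothPeriodic m) (hf : IsSmoothPeriodic f)
    (hg : IsSmoothPeriodic g) :
    pairing f (MuBurgers.pencil a b m g) = -pairing g (MuBurgers.pencil a b m f) := by
  rw [pairing_pencil a b hm hf hg, pairing_pencil a b hm hg hf, pairing_J0_zero hm hf hg,
    pairing_J0_zero hm hg hf, pairing_invD3 (hm.innerOp hf) (hm.innerOp hg),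
    pairing_comm (innerOp m g)]
  unfold J2
  rw [pairing_iteratedDeriv 5 hf hg, pairing_comm _ g]
  ring

theorem pencil_add_const_mul (a b : ℝ) (hm : IsSmoothPeriodic m) (hf : IsSmoothPeriodic f)
    (hg : IsSmoothPeriodic g) (c : ℝ) :
    pencil a b m (fun y => f y + c * g y) = fun x => pencil a b m f x + c * pencil a b m g x := by
  have h5 : ∀ n, iteratedDeriv n (fun y => f y + c * g y)
      = fun x => iteratedDeriv n f x + c * iteratedDeriv n g x := by
    intro n
    induction n with
    | zero => simp
    | succ n ih =>
      rw [iteratedDeriv_succ, ih, iteratedDeriv_succ, iteratedDeriv_succ]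
      funext x
      exact (((hf.iteratedDeriv n).hasDerivAt x).add
        (((hg.iteratedDeriv n).hasDerivAt x).const_mul c)).deriv
  funext x
  simp only [pencil, J0_zero, J2]
  rw [innerOp_add_const_mul m hf hg, invD3_add_const_mul (hm.innerOp hf) (hm.innerOp hg),
    outerOp_add_const_mul m (hm.innerOp hf).invD3 (hm.innerOp hg).invD3, h5]
  ring

theorem pencil_translate (a b : ℝ) (hm : IsSmoothPeriodic m) (hf : IsSmoothPeriodic f) (s : ℝ) :
    pencil a b (fun x => m (x + s)) (fun x => f (x + s)) = fun x => pencil a b m f (x + s) := by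
  have hd : ∀ f : ℝ → ℝ, deriv (fun x => f (x + s)) = fun x => deriv f (x + s) :=
    fun f => funext fun x => deriv_comp_add_const f s x
  have hi : ∀ n, iteratedDeriv n (fun x => f (x + s)) = fun x => iteratedDeriv n f (x + s) := by
    intro n
    induction n with
    | zero => simp
    | succ n ih => rw [iteratedDeriv_succ, ih, iteratedDeriv_succ, hd]
  have hI : innerOp (fun x => m (x + s)) (fun x => f (x + s)) = fun x => innerOp m f (x + s) := by
    unfold innerOp; rw [hd, hd]
  have h3 : invD^[3] (fun x => innerOp m f (x + s)) = fun x => invD^[3] (innerOp m f) (x + s) := by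
    change invD (invD (invD _)) = fun x => invD (invD (invD _)) (x + s)
    rw [invD_translate (hm.innerOp hf), invD_translate (hm.innerOp hf).invD,
      invD_translate (hm.innerOp hf).invD.invD]
  funext x
  simp only [pencil, J0_zero, J2]
  rw [hI, h3, hi]
  unfold outerOp
  rw [hd, hd]

end Pairing

section Families

variable {E : Type*} [NormedAddCommGroup E] [NormedSpace ℝ E]
variable {γ η : E → ℝ → ℝ}

theorem SmoothFam.const_mul (c : ℝ) (h : SmoothFam E γ) : SmoothFam E (fun s x => c * γ s x) :=
  (SmoothFam.const c).mul h

theorem SmoothFam.iteratedDeriv (h : SmoothFam E γ) (n : ℕ) :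
    SmoothFam E (fun s => iteratedDeriv n (γ s)) := by
  induction n with
  | zero => simpa only [iteratedDeriv_zero] using h
  | succ n ih => simpa only [iteratedDeriv_succ] using ih.deriv

theorem SmoothFam.outerOp (h : SmoothFam E γ) (k : SmoothFam E η) :
    SmoothFam E (fun s => outerOp (γ s) (η s)) :=
  (h.mul k.deriv).add ((h.deriv.const_mul (1 / 3)).mul k)

theorem SmoothFam.innerOp (h : SmoothFam E γ) (k : SmoothFam E η) :
    SmoothFam E (fun s => innerOp (γ s) (η s)) :=
  (h.mul k.deriv).add ((h.deriv.const_mul (2 / 3)).mul k)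

variable [FiniteDimensional ℝ E]

theorem SmoothFam.invD3 (h : SmoothFam E γ) : SmoothFam E (fun s => MuBurgers.invD^[3] (γ s)) :=
  h.invD'.invD'.invD'

theorem SmoothFam.pencil (a b : ℝ) (h : SmoothFam E γ) (k : SmoothFam E η) :
    SmoothFam E (fun s => pencil a b (γ s) (η s)) := by
  unfold MuBurgers.pencil
  simp only [J0_zero, J2]
  exact ((h.outerOp (h.innerOp k).invD3).neg.const_mul a).add ((k.iteratedDeriv 5).const_mul b)

end Families

/-! ### First variation of the bracket of the pencil -/

section Variation

variable {γ η : ℝ → ℝ → ℝ} {γ' η' : ℝ → ℝ}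

theorem HasDot.outerOp (h : HasDot γ γ') (k : HasDot η η') :
    HasDot (fun ε => outerOp (γ ε) (η ε))
      (fun x => outerOp γ' (η 0) x + MuBurgers.outerOp (γ 0) η' x) := by
  have := (h.mul k.deriv).add ((h.deriv.const_mul (1 / 3)).mul k)
  refine ⟨this.1, fun x => (this.2 x).congr_deriv ?_⟩
  simp only [MuBurgers.outerOp]
  ring

theorem HasDot.innerOp (h : HasDot γ γ') (k : HasDot η η') :
    HasDot (fun ε => innerOp (γ ε) (η ε))
      (fun x => innerOp γ' (η 0) x + MuBurgers.innerOp (γ 0) η' x) := by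
  have := (h.mul k.deriv).add ((h.deriv.const_mul (2 / 3)).mul k)
  refine ⟨this.1, fun x => (this.2 x).congr_deriv ?_⟩
  simp only [MuBurgers.innerOp]
  ring

theorem HasDot.invD3 (h : HasDot γ γ') :
    HasDot (fun ε => MuBurgers.invD^[3] (γ ε)) (MuBurgers.invD^[3] γ') :=
  h.invD.invD.invD

/-- The gradient with respect to `m` of `⟨f, J₀ g⟩` for fixed `f` and `g`. -/
noncomputable def J0Grad (m f g : ℝ → ℝ) : ℝ → ℝ := fun x =>
  1 / 3 * (deriv f x * invD^[3] (innerOp m g) x - 2 * f x * deriv (invD^[3] (innerOp m g)) x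
    - deriv g x * invD^[3] (innerOp m f) x + 2 * g x * deriv (invD^[3] (innerOp m f)) x)

theorem SmoothFam.J0Grad {E : Type*} [NormedAddCommGroup E] [NormedSpace ℝ E]
    [FiniteDimensional ℝ E] {γ η ζ : E → ℝ → ℝ}
    (h : SmoothFam E γ) (k : SmoothFam E η) (l : SmoothFam E ζ) :
    SmoothFam E (fun s => J0Grad (γ s) (η s) (ζ s)) :=
  ((((k.deriv.mul (h.innerOp l).invD3).sub ((k.const_mul 2).mul (h.innerOp l).invD3.deriv)).sub
    (l.deriv.mul (h.innerOp k).invD3)).add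
      ((l.const_mul 2).mul (h.innerOp k).invD3.deriv)).const_mul (1 / 3)

variable {f g m v : ℝ → ℝ}

theorem IsSmoothPeriodic.J0Grad (hm : IsSmoothPeriodic m) (hf : IsSmoothPeriodic f)
    (hg : IsSmoothPeriodic g) : IsSmoothPeriodic (J0Grad m f g) :=
  (SmoothFam.J0Grad (E := ℝ) hm.fam hf.fam hg.fam).slice 0

/-- Integrating by parts with the boundary function `(2/3) v f B` removes the derivative from `v`.
-/
theorem pairing_innerOp_direction {B : ℝ → ℝ} (hv : IsSmoothPeriodic v) (hf : IsSmoothPeriodic f)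
    (hB : IsSmoothPeriodic B) :
    pairing (innerOp v f) B = pairing v (fun x => 1 / 3 * (deriv f x * B x - 2 * f x * deriv B x)) := by
  have hr := ((hf.deriv.mul hB).sub ((hf.const_mul 2).mul hB.deriv)).const_mul (1 / 3)
  have h := mean_eq_zero_of_hasDerivAt (W := fun x => 2 / 3 * (v x * (f x * B x)))
    (w := fun x => innerOp v f x * B x - v x * (1 / 3 * (deriv f x * B x - 2 * f x * deriv B x)))
    (fun x => by
      refine (((hv.hasDerivAt x).mul ((hf.hasDerivAt x).mul (hB.hasDerivAt x))).const_mul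
        (2 / 3)).congr_deriv ?_
      simp only [innerOp, Pi.mul_apply]
      ring)
    (((hv.innerOp hf).mul hB).sub (hv.mul hr)).continuous
    (by have := ((hv.mul (hf.mul hB)).const_mul (2 / 3)).2 0; simpa using this)
  rw [mean_sub ((hv.innerOp hf).mul hB) (hv.mul hr)] at h
  exact sub_eq_zero.1 h

/-- `J₀` contains `m` twice. Adjointness of the outer and inner operators and skewness of `∂_x⁻³`
turn both variations into the form of `pairing_innerOp_direction`, with `f` and `g` exchanged and
opposite signs. -/
theorem pairing_J0_direction (hm : IsSmoothPeriodic m) (hv : IsSmoothPeriodic v)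
    (hf : IsSmoothPeriodic f) (hg : IsSmoothPeriodic g) :
    pairing f (fun x => -(outerOp v (invD^[3] (innerOp m g)) x
      + outerOp m (invD^[3] (innerOp v g)) x)) = pairing v (J0Grad m f g) := by
  have hA := (hm.innerOp hf).invD3
  have hB := (hm.innerOp hg).invD3
  have hf1 := ((hf.deriv.mul hB).sub ((hf.const_mul 2).mul hB.deriv)).const_mul (1 / 3)
  have hg1 := ((hg.deriv.mul hA).sub ((hg.const_mul 2).mul hA.deriv)).const_mul (1 / 3)
  rw [pairing_neg_right, pairing_add_right hf (hv.outerOp hB) (hm.outerOp (hv.innerOp hg).invD3),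
    pairing_outerOp hv hf hB, pairing_outerOp hm hf (hv.innerOp hg).invD3,
    pairing_invD3 (hm.innerOp hf) (hv.innerOp hg), pairing_comm (invD^[3] _),
    pairing_innerOp_direction hv hf hB, pairing_innerOp_direction hv hg hA]
  have e : J0Grad m f g = fun x => 1 / 3 * (deriv f x * invD^[3] (innerOp m g) x
      - 2 * f x * deriv (invD^[3] (innerOp m g)) x) - 1 / 3 * (deriv g x * invD^[3] (innerOp m f) x
      - 2 * g x * deriv (invD^[3] (innerOp m f)) x) := by
    funext x; simp only [J0Grad]; ring
  rw [e, pairing_sub_right hv hf1 hg1]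
  ring

variable {F G : (ℝ → ℝ) → ℝ} {δF δG : (ℝ → ℝ) → ℝ → ℝ}

/-- Product rule: the variation of `δG` is moved to the left factor by skewness of the pencil. Only
`J₀` contributes a term from its coefficients, since `J₂` does not depend on `m`. -/
theorem hasDerivAt_bracket_pencil (a b : ℝ) (hF : IsFunctional F δF) (hG : IsFunctional G δG)
    (hm : IsSmoothPeriodic m) (hv : IsSmoothPeriodic v) :
    HasDerivAt (fun ε : ℝ => bracket (pencil a b) δF δG (fun x => m x + ε * v x))
      (pairing (dirDeriv δF m v) (pencil a b m (δG m))
        - pairing (dirDeriv δG m v) (pencil a b m (δF m))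
        + a * pairing v (J0Grad m (δF m) (δG m))) 0 := by
  have hf := hF.hasDot hm hv
  have hg := hG.hasDot hm hv
  have hl := HasDot.line hm hv
  have hJ := ((hl.outerOp (hl.innerOp hg).invD3).neg.const_mul a).add
    ((hg.iteratedDeriv 5).const_mul b)
  have h1 := (hf.mul hJ).mean
  simp only [zero_mul, add_zero] at h1
  have hfm := hF.isSmoothPeriodic hm
  have hgm := hG.isSmoothPeriodic hm
  have hf' := hf.isSmoothPeriodic
  have hg' := hg.isSmoothPeriodic
  have e1 : (fun ε : ℝ => bracket (pencil a b) δF δG (fun x => m x + ε * v x))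
      = fun ε => mean fun x => δF (fun y => m y + ε * v y) x *
        (a * -outerOp (fun x => m x + ε * v x) (invD^[3] (innerOp (fun x => m x + ε * v x)
          (δG fun y => m y + ε * v y))) x + b * iteratedDeriv 5 (δG fun y => m y + ε * v y) x) := by
    funext ε
    simp only [bracket, pencil, J0_zero, J2, mean]
  rw [e1]
  refine h1.congr_deriv ?_
  have e2 : invD^[3] (fun x => innerOp v (δG m) x + innerOp m (dirDeriv δG m v) x)
      = fun x => invD^[3] (innerOp v (δG m)) x + 1 * invD^[3] (innerOp m (dirDeriv δG m v)) x := by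
    rw [← invD3_add_const_mul (hv.innerOp hgm) (hm.innerOp hg')]
    simp only [one_mul]
  rw [e2, outerOp_add_const_mul m (hv.innerOp hgm).invD3 (hm.innerOp hg').invD3]
  have e3 : (fun x => dirDeriv δF m v x * (a * -outerOp m (invD^[3] (innerOp m (δG m))) x
        + b * iteratedDeriv 5 (δG m) x)
      + δF m x * (a * -(outerOp v (invD^[3] (innerOp m (δG m))) x +
          (outerOp m (invD^[3] (innerOp v (δG m))) x
            + 1 * outerOp m (invD^[3] (innerOp m (dirDeriv δG m v))) x))
        + b * iteratedDeriv 5 (dirDeriv δG m v) x))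
      = fun x => (dirDeriv δF m v x * pencil a b m (δG m) x
        + δF m x * pencil a b m (dirDeriv δG m v) x)
        + δF m x * (a * -(outerOp v (invD^[3] (innerOp m (δG m))) x
          + outerOp m (invD^[3] (innerOp v (δG m))) x)) := by
    funext x
    simp only [pencil, J0_zero, J2]
    ring
  rw [e3, mean_add ((hf'.mul (hm.pencil a b hgm)).add (hfm.mul (hm.pencil a b hg')))
    (hfm.mul (((hv.outerOp (hm.innerOp hgm).invD3).add
      (hm.outerOp (hv.innerOp hgm).invD3)).neg.const_mul a)),
    mean_add (hf'.mul (hm.pencil a b hgm)) (hfm.mul (hm.pencil a b hg'))]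
  change pairing _ _ + pairing _ _ + pairing _ (fun x => a * _) = _
  rw [pairing_const_mul_right, pairing_J0_direction hm hv hfm hgm,
    pairing_pencil_skew a b hm hfm hg']
  ring

/-- Symmetry of the Hessians takes the direction `v` out of the directional derivatives and so
exhibits a gradient. Equivariance of the gradients and of the pencil gives translation invariance.
-/
theorem isFunctional_bracket_pencil (a b : ℝ) (hF : IsFunctional F δF) (hG : IsFunctional G δG) :
    IsFunctional (bracket (pencil a b) δF δG)
      (fun m x => dirDeriv δF m (pencil a b m (δG m)) x - dirDeriv δG m (pencil a b m (δF m)) x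
        + a * J0Grad m (δF m) (δG m) x) where
  variation m v hm hv := by
    have hf := hF.isSmoothPeriodic hm
    have hg := hG.isSmoothPeriodic hm
    have hJf := hm.pencil a b hf
    have hJg := hm.pencil a b hg
    refine (hasDerivAt_bracket_pencil a b hF hG hm hv).congr_deriv ?_
    rw [pairing, hF.dirDeriv_symm hm hv hJg, pairing, hG.dirDeriv_symm hm hv hJf]
    have h1 := (hF.hasDot hm hJg).isSmoothPeriodic
    have h2 := (hG.hasDot hm hJf).isSmoothPeriodic
    have h3 := pairing_add_right hv (h1.sub h2) ((hm.J0Grad hf hg).const_mul a)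
    rw [pairing_sub_right hv h1 h2, pairing_const_mul_right, pairing_comm v, pairing_comm v,
      pairing_comm v] at h3
    exact h3.symm
  smooth k γ hγ := by
    have h : SmoothFam _ γ := hγ
    have hf := hF.fam h
    have hg := hG.fam h
    exact ((hF.dirDeriv_fam h (h.pencil a b hg)).sub (hG.dirDeriv_fam h (h.pencil a b hf))).add
      ((h.J0Grad hf hg).const_mul a)
  translation m hm s := by
    have hf := hF.isSmoothPeriodic hm
    have hg := hG.isSmoothPeriodic hm
    unfold bracket
    rw [hF.equivariant hm, hG.equivariant hm, pencil_translate a b hm hg]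
    exact (hf.mul (hm.pencil a b hg)).mean_translate s

end Variation

/-! ### The Jacobi identity -/

/-- `f 0, f 1, f 2, …` are the successive derivatives of a smooth function on the circle. -/
structure IsJet (f : ℕ → ℝ → ℝ) : Prop where
  hasDerivAt : ∀ i x, HasDerivAt (f i) (f (i + 1) x) x
  periodic : ∀ i, f i 1 = f i 0

theorem IsJet.continuous {f : ℕ → ℝ → ℝ} (hf : IsJet f) (i : ℕ) : Continuous (f i) :=
  continuous_iff_continuousAt.2 fun x => (hf.hasDerivAt i x).continuousAt

theorem IsSmoothPeriodic.isJet {f : ℝ → ℝ} (hf : IsSmoothPeriodic f) :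
    IsJet (fun i => _root_.iteratedDeriv i f) where
  hasDerivAt i x := by
    rw [iteratedDeriv_succ]
    exact (hf.iteratedDeriv i).hasDerivAt x
  periodic i := by simpa using (hf.iteratedDeriv i).2 0

variable {m f g h A B C : ℕ → ℝ → ℝ}

/-- The integrand is the derivative of the Wronskian determinant of `A, B, C`, in which only the
terms with a third derivative survive. -/
theorem mean_jacobi_J0 (hm : IsJet m) (hf : IsJet f) (hg : IsJet g) (hh : IsJet h)
    (hA : IsJet A) (hB : IsJet B) (hC : IsJet C)
    (hA3 : ∀ x, A 3 x = m 0 x * f 1 x + 2 / 3 * m 1 x * f 0 x)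
    (hB3 : ∀ x, B 3 x = m 0 x * g 1 x + 2 / 3 * m 1 x * g 0 x)
    (hC3 : ∀ x, C 3 x = m 0 x * h 1 x + 2 / 3 * m 1 x * h 0 x) :
    mean (fun x =>
      (m 0 x * C 1 x + 1 / 3 * m 1 x * C 0 x) *
        (f 1 x * B 0 x - 2 * f 0 x * B 1 x - g 1 x * A 0 x + 2 * g 0 x * A 1 x)
      + (m 0 x * A 1 x + 1 / 3 * m 1 x * A 0 x) *
        (g 1 x * C 0 x - 2 * g 0 x * C 1 x - h 1 x * B 0 x + 2 * h 0 x * B 1 x)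
      + (m 0 x * B 1 x + 1 / 3 * m 1 x * B 0 x) *
        (h 1 x * A 0 x - 2 * h 0 x * A 1 x - f 1 x * C 0 x + 2 * f 0 x * C 1 x)) = 0 := by
  have cm := hm.continuous
  have cf := hf.continuous
  have cg := hg.continuous
  have ch := hh.continuous
  have cA := hA.continuous
  have cB := hB.continuous
  have cC := hC.continuous
  refine mean_eq_zero_of_hasDerivAt (W := fun x =>
    A 2 x * (B 0 x * C 1 x - B 1 x * C 0 x) + B 2 x * (C 0 x * A 1 x - C 1 x * A 0 x)
      + C 2 x * (A 0 x * B 1 x - A 1 x * B 0 x)) (fun x => ?_) (by fun_prop) ?_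
  · have a := fun i => hA.hasDerivAt i x
    have b := fun i => hB.hasDerivAt i x
    have c := fun i => hC.hasDerivAt i x
    refine ((((a 2).mul (((b 0).mul (c 1)).sub ((b 1).mul (c 0)))).add
      ((b 2).mul (((c 0).mul (a 1)).sub ((c 1).mul (a 0))))).add
      ((c 2).mul (((a 0).mul (b 1)).sub ((a 1).mul (b 0))))).congr_deriv ?_
    simp only [Pi.mul_apply, Pi.sub_apply, Nat.reduceAdd, hA3, hB3, hC3]
    ring
  · simp only [hA.periodic, hB.periodic, hC.periodic]

theorem IsJet.hasDerivAt_wronskian (hg : IsJet g) (hh : IsJet h) (i j : ℕ) (x : ℝ) :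
    HasDerivAt (fun x => g i x * h j x - g j x * h i x)
      ((g (i + 1) x * h j x - g j x * h (i + 1) x) + (g i x * h (j + 1) x - g (j + 1) x * h i x))
      x := by
  refine (((hg.hasDerivAt i x).mul (hh.hasDerivAt j x)).sub
    ((hg.hasDerivAt j x).mul (hh.hasDerivAt i x))).congr_deriv ?_
  ring

/-- With `K = 2(g'''h - g h''') - 3(g''h' - g'h'')`, the primitive is `A K'' - A' K' + A'' K - (2/3)
m f K - 2 A (g⁽⁵⁾h - g h⁽⁵⁾)`. The first three terms trade `A K'''` for `A''' K`, the fourth removes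
`m'` once `A'''` is substituted, and the last corrects the terms of sixth order in `K'''`. -/
theorem mean_jacobi_J2_aux (hm : IsJet m) (hf : IsJet f) (hg : IsJet g) (hh : IsJet h)
    (hA : IsJet A) (hA3 : ∀ x, A 3 x = m 0 x * f 1 x + 2 / 3 * m 1 x * f 0 x) :
    mean (fun x => g 5 x * (h 1 x * A 0 x - 2 * h 0 x * A 1 x)
        - h 5 x * (g 1 x * A 0 x - 2 * g 0 x * A 1 x)
        + 1 / 3 * m 0 x * (f 1 x * (2 * (g 3 x * h 0 x - g 0 x * h 3 x)
            - 3 * (g 2 x * h 1 x - g 1 x * h 2 x))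
          - 2 * f 0 x * (2 * (g 4 x * h 0 x - g 0 x * h 4 x)
            - (g 3 x * h 1 x - g 1 x * h 3 x)))) = 0 := by
  have cm := hm.continuous
  have cf := hf.continuous
  have cg := hg.continuous
  have ch := hh.continuous
  have cA := hA.continuous
  refine mean_eq_zero_of_hasDerivAt (W := fun x =>
    A 0 x * (2 * (g 5 x * h 0 x - g 0 x * h 5 x) + (g 4 x * h 1 x - g 1 x * h 4 x)
        - (g 3 x * h 2 x - g 2 x * h 3 x))
      - A 1 x * (2 * (g 4 x * h 0 x - g 0 x * h 4 x) - (g 3 x * h 1 x - g 1 x * h 3 x))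
      + A 2 x * (2 * (g 3 x * h 0 x - g 0 x * h 3 x) - 3 * (g 2 x * h 1 x - g 1 x * h 2 x))
      - 2 / 3 * (m 0 x * (f 0 x * (2 * (g 3 x * h 0 x - g 0 x * h 3 x)
        - 3 * (g 2 x * h 1 x - g 1 x * h 2 x))))
      - 2 * (A 0 x * (g 5 x * h 0 x - g 0 x * h 5 x))) (fun x => ?_) (by fun_prop) ?_
  · have a := fun i => hA.hasDerivAt i x
    have w := fun i j => hg.hasDerivAt_wronskian hh i j x
    refine ((((((a 0).mul ((((w 5 0).const_mul 2).add (w 4 1)).sub (w 3 2))).sub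
      ((a 1).mul (((w 4 0).const_mul 2).sub (w 3 1)))).add
      ((a 2).mul (((w 3 0).const_mul 2).sub ((w 2 1).const_mul 3)))).sub
      (((hm.hasDerivAt 0 x).mul ((hf.hasDerivAt 0 x).mul
        (((w 3 0).const_mul 2).sub ((w 2 1).const_mul 3)))).const_mul (2 / 3))).sub
      (((a 0).mul (w 5 0)).const_mul 2)).congr_deriv ?_
    simp only [Pi.mul_apply, Pi.sub_apply, Pi.add_apply, Nat.reduceAdd, zero_add, hA3]
    ring
  · simp only [hA.periodic, hm.periodic, hf.periodic, hg.periodic, hh.periodic]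

/-- Collecting the terms by `A`, `B` and `C` gives the cyclic images of the auxiliary identity;
their local terms, those with a factor `m`, cancel in the cyclic sum. -/
theorem mean_jacobi_J2 (hm : IsJet m) (hf : IsJet f) (hg : IsJet g) (hh : IsJet h)
    (hA : IsJet A) (hB : IsJet B) (hC : IsJet C)
    (hA3 : ∀ x, A 3 x = m 0 x * f 1 x + 2 / 3 * m 1 x * f 0 x)
    (hB3 : ∀ x, B 3 x = m 0 x * g 1 x + 2 / 3 * m 1 x * g 0 x)
    (hC3 : ∀ x, C 3 x = m 0 x * h 1 x + 2 / 3 * m 1 x * h 0 x) :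
    mean (fun x =>
      h 5 x * (f 1 x * B 0 x - 2 * f 0 x * B 1 x - g 1 x * A 0 x + 2 * g 0 x * A 1 x)
      + f 5 x * (g 1 x * C 0 x - 2 * g 0 x * C 1 x - h 1 x * B 0 x + 2 * h 0 x * B 1 x)
      + g 5 x * (h 1 x * A 0 x - 2 * h 0 x * A 1 x - f 1 x * C 0 x + 2 * f 0 x * C 1 x)) = 0 := by
  have cm := hm.continuous
  have cf := hf.continuous
  have cg := hg.continuous
  have ch := hh.continuous
  have cA := hA.continuous
  have cB := hB.continuous
  have cC := hC.continuous
  have h1 := mean_jacobi_J2_aux hm hf hg hh hA hA3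
  have h2 := mean_jacobi_J2_aux hm hg hh hf hB hB3
  have h3 := mean_jacobi_J2_aux hm hh hf hg hC hC3
  unfold mean at h1 h2 h3 ⊢
  have h4 := congrArg₂ (· + ·) (congrArg₂ (· + ·) h1 h2) h3
  simp only [add_zero] at h4
  rw [← intervalIntegral.integral_add (Continuous.intervalIntegrable (by fun_prop) _ _)
    (Continuous.intervalIntegrable (by fun_prop) _ _),
    ← intervalIntegral.integral_add (Continuous.intervalIntegrable (by fun_prop) _ _)
    (Continuous.intervalIntegrable (by fun_prop) _ _)] at h4
  refine Eq.trans (intervalIntegral.integral_congr fun x _ => ?_) h4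
  ring

theorem IsSmoothPeriodic.deriv3_invD3 {f : ℝ → ℝ} (hf : IsSmoothPeriodic f) (h0 : mean f = 0) :
    _root_.iteratedDeriv 3 (MuBurgers.invD^[3] f) = f := by
  have h1 : _root_.deriv (MuBurgers.invD f) = f := by rw [hf.deriv_invD, h0]; simp
  have h2 : _root_.deriv (MuBurgers.invD (MuBurgers.invD f)) = MuBurgers.invD f := by
    rw [hf.invD.deriv_invD, hf.mean_invD]; simp
  have h3 : _root_.deriv (MuBurgers.invD (MuBurgers.invD (MuBurgers.invD f)))
      = MuBurgers.invD (MuBurgers.invD f) := by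
    rw [hf.invD.invD.deriv_invD, hf.invD.mean_invD]; simp
  rw [iteratedDeriv_succ, iteratedDeriv_succ, iteratedDeriv_succ, iteratedDeriv_zero]
  change _root_.deriv (_root_.deriv (_root_.deriv (MuBurgers.invD (MuBurgers.invD (MuBurgers.invD f)))))
    = f
  rw [h3, h2, h1]

theorem pencil_jacobi (a b : ℝ) {m f g h : ℝ → ℝ} (hm : IsSmoothPeriodic m)
    (hf : IsSmoothPeriodic f) (hg : IsSmoothPeriodic g) (hh : IsSmoothPeriodic h)
    (hf0 : mean (innerOp m f) = 0) (hg0 : mean (innerOp m g) = 0)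
    (hh0 : mean (innerOp m h) = 0) :
    pairing (pencil a b m h) (J0Grad m f g) + pairing (pencil a b m f) (J0Grad m g h)
      + pairing (pencil a b m g) (J0Grad m h f) = 0 := by
  have jm := hm.isJet
  have jf := hf.isJet
  have jg := hg.isJet
  have jh := hh.isJet
  have jA := (hm.innerOp hf).invD3.isJet
  have jB := (hm.innerOp hg).invD3.isJet
  have jC := (hm.innerOp hh).invD3.isJet
  have e : ∀ f : ℝ → ℝ, IsSmoothPeriodic f → mean (innerOp m f) = 0 → ∀ x,
      iteratedDeriv 3 (invD^[3] (innerOp m f)) x = iteratedDeriv 0 m x * iteratedDeriv 1 f x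
        + 2 / 3 * iteratedDeriv 1 m x * iteratedDeriv 0 f x := fun f hf h0 x => by
    rw [(hm.innerOp hf).deriv3_invD3 h0]; simp [innerOp]
  have h1 := mean_jacobi_J0 jm jf jg jh jA jB jC (e f hf hf0) (e g hg hg0) (e h hh hh0)
  have h2 := mean_jacobi_J2 jm jf jg jh jA jB jC (e f hf hf0) (e g hg hg0) (e h hh hh0)
  have c := fun i => jm.continuous i
  have cf := fun i => jf.continuous i
  have cg := fun i => jg.continuous i
  have ch := fun i => jh.continuous i
  have cA := fun i => jA.continuous i
  have cB := fun i => jB.continuous i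
  have cC := fun i => jC.continuous i
  unfold mean at h1 h2
  -- The factor 1/3 is that of `J0Grad`; the minus sign is that in `J₀`.
  have h3 := congrArg₂ (· + ·) (congrArg (-(a / 3) * ·) h1) (congrArg (b / 3 * ·) h2)
  simp only [mul_zero, add_zero] at h3
  rw [← intervalIntegral.integral_const_mul, ← intervalIntegral.integral_const_mul,
    ← intervalIntegral.integral_add (Continuous.intervalIntegrable (by fun_prop) _ _)
    (Continuous.intervalIntegrable (by fun_prop) _ _)] at h3
  unfold pairing
  rw [← mean_add ((hm.pencil a b hh).mul (hm.J0Grad hf hg))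
    ((hm.pencil a b hf).mul (hm.J0Grad hg hh)),
    ← mean_add (((hm.pencil a b hh).mul (hm.J0Grad hf hg)).add
    ((hm.pencil a b hf).mul (hm.J0Grad hg hh))) ((hm.pencil a b hg).mul (hm.J0Grad hh hf))]
  refine Eq.trans (intervalIntegral.integral_congr fun x _ => ?_) h3
  simp only [pencil, J0_zero, J2, J0Grad, outerOp, iteratedDeriv_zero, iteratedDeriv_one]
  ring

/-- After integration by parts, both terms are multiples of `∫ (δF/δm) m_x`, which vanishes by
translation invariance. -/
theorem IsFunctional.mean_innerOp {F : (ℝ → ℝ) → ℝ} {f : (ℝ → ℝ) → ℝ → ℝ}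
    (hF : IsFunctional F f) {m : ℝ → ℝ} (hm : IsSmoothPeriodic m) :
    mean (innerOp m (f m)) = 0 := by
  have hf := hF.isSmoothPeriodic hm
  have h1 : mean (fun x => m x * deriv (f m) x) = 0 := by
    have h2 := hm.integral_mul_deriv hf
    have h3 := hF.mean_mul_deriv hm
    simp only [mul_comm (f m _)] at h3
    unfold mean at h3 ⊢
    rw [h2, h3, neg_zero]
  have h4 : mean (fun x => 2 / 3 * deriv m x * f m x) = 0 := by
    have h3 := hF.mean_mul_deriv hm
    have e : (fun x => 2 / 3 * deriv m x * f m x) = fun x => 2 / 3 * (f m x * deriv m x) := by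
      funext x; ring
    rw [e, mean_const_mul, h3, mul_zero]
  unfold innerOp
  rw [mean_add (hm.mul hf.deriv) ((hm.deriv.const_mul _).mul hf), h1, h4, add_zero]

theorem isHamiltonian_pencil (a b : ℝ) : IsHamiltonian (pencil a b) where
  smooth m f hm hf := hm.pencil a b hf
  linear m f g hm hf hg c x := congrFun (pencil_add_const_mul a b hm hf hg c) x
  skew m f g hm hf hg := pairing_pencil_skew a b hm hf hg
  closed F G f g hF hG := ⟨_, isFunctional_bracket_pencil a b hF hG⟩
  jacobi F G H f g h fg gh hf hF hG hH hFG hGH hHF m hm := by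
    have sf := hF.isSmoothPeriodic hm
    have sg := hG.isSmoothPeriodic hm
    have sh := hH.isSmoothPeriodic hm
    have Jf := hm.pencil a b sf
    have Jg := hm.pencil a b sg
    have Jh := hm.pencil a b sh
    -- The given gradient is arbitrary, but its pairing with `J δH` is the derivative of `{F, G}` in
    -- that direction, and so agrees with the computed one.
    have e1 : bracket (pencil a b) fg h m = _ :=
      (hFG.variation m _ hm Jh).unique (hasDerivAt_bracket_pencil a b hF hG hm Jh)
    have e2 : bracket (pencil a b) gh f m = _ :=
      (hGH.variation m _ hm Jf).unique (hasDerivAt_bracket_pencil a b hG hH hm Jf)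
    have e3 : bracket (pencil a b) hf g m = _ :=
      (hHF.variation m _ hm Jg).unique (hasDerivAt_bracket_pencil a b hH hF hm Jg)
    -- Symmetry of the three Hessians makes the six second-variation terms cancel in pairs.
    have s1 : pairing (dirDeriv f m _) _ = pairing (dirDeriv f m _) _ := hF.dirDeriv_symm hm Jh Jg
    have s2 : pairing (dirDeriv g m _) _ = pairing (dirDeriv g m _) _ := hG.dirDeriv_symm hm Jf Jh
    have s3 : pairing (dirDeriv h m _) _ = pairing (dirDeriv h m _) _ := hH.dirDeriv_symm hm Jg Jf
    have key := pencil_jacobi a b hm sf sg sh (hF.mean_innerOp hm) (hG.mean_innerOp hm)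
      (hH.mean_innerOp hm)
    rw [e1, e2, e3, s1, s2, s3]
    linear_combination a * key

/-- The bracket of `J₀` does not depend on the constant of integration. -/
theorem bracket_J0_eq {F G : (ℝ → ℝ) → ℝ} {f g : (ℝ → ℝ) → ℝ → ℝ} (hF : IsFunctional F f)
    (hG : IsFunctional G g) {m : ℝ → ℝ} (hm : IsSmoothPeriodic m) (κ : ℝ) :
    bracket (J0 κ) f g m = bracket (J0 0) f g m := by
  have sf := hF.isSmoothPeriodic hm
  have sg := hG.isSmoothPeriodic hm
  have hB := (hm.innerOp sg).invD3
  -- The constant `κ` contributes `-(κ/3) m_x`, which is orthogonal to `δF/δm`.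
  have e : J0 κ m (g m) = fun x => J0 0 m (g m) x + -κ * (1 / 3 * deriv m x) := by
    funext x
    have h1 := outerOp_add_const_mul m hB (IsSmoothPeriodic.const 1) κ
    simp only [mul_one] at h1
    rw [J0_zero]
    simp only [J0]
    rw [h1]
    simp only [outerOp, deriv_const]
    ring
  change pairing (f m) (J0 κ m (g m)) = pairing (f m) (J0 0 m (g m))
  rw [e, pairing_add_right sf (hm.J0 0 sg) ((hm.deriv.const_mul _).const_mul _),
    pairing_const_mul_right, pairing_const_mul_right]
  have : pairing (f m) (deriv m) = 0 := hF.mean_mul_deriv hm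
  rw [this]; simp

/-! ### The Hamiltonian functionals -/

theorem isFunctional_H0 : IsFunctional H0 (fun _ _ => -(9 / 2)) where
  variation m v hm hv := by
    have h := (((HasDot.line hm hv).mean).const_mul (-(9 / 2)))
    refine h.congr_deriv ?_
    rw [intervalIntegral.integral_const_mul]
    rfl
  smooth _ _ _ := (SmoothFam.const _ : SmoothFam _ _)
  translation m hm a := by
    unfold H0
    exact congrArg _ (hm.mean_translate a)

theorem SmoothFam.velocity {E : Type*} [NormedAddCommGroup E] [NormedSpace ℝ E]
    [FiniteDimensional ℝ E] {γ : E → ℝ → ℝ} (h : SmoothFam E γ) (c : ℝ) :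
    SmoothFam E (fun s => velocity c (γ s)) :=
  (SmoothFam.const c).sub h.invD'.invD'

theorem IsSmoothPeriodic.velocity {m : ℝ → ℝ} (hm : IsSmoothPeriodic m) (c : ℝ) :
    IsSmoothPeriodic (velocity c m) :=
  (IsSmoothPeriodic.const c).sub hm.invD.invD

/-- The variation of `u` is `-∂_x⁻² v`, so that of `H₂` is `(1/2) ∫ u² ∂_x⁻² v`, and `∂_x⁻²` is
symmetric. -/
theorem isFunctional_H2 (c : ℝ) :
    IsFunctional (H2 c) (fun m x => 1 / 2 * invD^[2] (fun y => velocity c m y * velocity c m y) x) where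
  variation m v hm hv := by
    have hu := (HasDot.const (IsSmoothPeriodic.const c)).sub (HasDot.line hm hv).invD.invD
    have h := ((hu.mul (hu.mul hu)).mean).const_mul (-(1 / 6))
    have su := hm.velocity c
    have e : (fun ε : ℝ => H2 c fun x => m x + ε * v x) = fun ε => -(1 / 6) * mean fun x =>
        (c - invD (invD fun x => m x + ε * v x) x) * ((c - invD (invD fun x => m x + ε * v x) x) *
          (c - invD (invD fun x => m x + ε * v x) x)) := by
      funext ε
      unfold H2 mean
      congr 1
      refine intervalIntegral.integral_congr fun x _ => ?_
      change (c - invD (invD _) x) ^ 3 = _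
      ring
    rw [e]
    refine h.congr_deriv ?_
    simp only [zero_mul, add_zero]
    have h1 := pairing_invD (su.mul su) hv.invD
    rw [pairing_invD (su.mul su).invD hv, neg_neg] at h1
    have h2 := pairing_const_mul_right (1 / 2) v (invD (invD fun x => velocity c m x * velocity c m x))
    rw [pairing_comm, pairing_comm v, ← h1] at h2
    refine Eq.trans ?_ h2.symm
    unfold pairing
    rw [← mean_const_mul, ← mean_const_mul]
    refine intervalIntegral.integral_congr fun x _ => ?_
    change _ = 1 / 2 * ((c - invD (invD m) x) * (c - invD (invD m) x) * invD (invD v) x)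
    ring
  smooth k γ hγ := by
    have h : SmoothFam _ γ := hγ
    exact ((h.velocity c).mul (h.velocity c)).invD'.invD'.const_mul (1 / 2)
  translation m hm a := by
    have e : velocity c (fun x => m (x + a)) = fun x => velocity c m (x + a) := by
      unfold velocity
      change (fun x => c - invD (invD _) x) = fun x => c - invD (invD m) (x + a)
      rw [invD_translate hm, invD_translate hm.invD]
    have su := hm.velocity c
    have e3 : (fun x => velocity c m x * (velocity c m x * velocity c m x))
      = fun x => velocity c m x ^ 3 := by funext x; ring
    have s3 := su.mul (su.mul su)
    rw [e3] at s3
    unfold H2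
    rw [e]
    exact congrArg _ (s3.mean_translate a)

theorem IsSmoothPeriodic.momentum {u : ℝ → ℝ} (hu : IsSmoothPeriodic u) :
    IsSmoothPeriodic (momentum u) := (hu.iteratedDeriv 2).neg

theorem momentum_eq (u : ℝ → ℝ) : momentum u = fun x => -deriv (deriv u) x := by
  funext x
  rw [momentum, iteratedDeriv_succ, iteratedDeriv_one]

theorem mean_neg (f : ℝ → ℝ) : mean (fun x => -f x) = -mean f := by
  simpa using mean_const_mul (-1) f

theorem mean_momentum {u : ℝ → ℝ} (hu : IsSmoothPeriodic u) : mean (momentum u) = 0 := by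
  rw [momentum_eq, mean_neg, hu.deriv.mean_deriv, neg_zero]

theorem invD2_momentum {u : ℝ → ℝ} (hu : IsSmoothPeriodic u) :
    invD (invD (momentum u)) = fun x => mean u - u x := by
  have h1 : (fun x => -deriv u x) = invD (momentum u) := by
    refine hu.momentum.invD_unique (fun x => ?_) ?_
    · rw [mean_momentum hu, sub_zero, momentum_eq]
      exact (hu.deriv.hasDerivAt x).neg
    · rw [mean_neg, hu.mean_deriv, neg_zero]
  rw [← h1]
  symm
  refine hu.deriv.neg.invD_unique (fun x => ?_) ?_
  · rw [mean_neg, hu.mean_deriv, neg_zero, sub_zero]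
    exact (hu.hasDerivAt x).const_sub _
  · rw [mean_sub (IsSmoothPeriodic.const _) hu, mean_const, sub_self]

theorem velocity_momentum {u : ℝ → ℝ} (hu : IsSmoothPeriodic u) :
    velocity (mean u) (momentum u) = u := by
  funext x
  change mean u - invD (invD (momentum u)) x = u x
  rw [invD2_momentum hu]; ring

theorem invD_const_mul {f : ℝ → ℝ} (hf : IsSmoothPeriodic f) (c : ℝ) :
    invD (fun x => c * f x) = fun x => c * invD f x := by
  symm
  refine (hf.const_mul c).invD_unique (fun x => ?_) ?_
  · rw [mean_const_mul, ← mul_sub]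
    exact (hf.invD_hasDerivAt x).const_mul c
  · rw [mean_const_mul, hf.mean_invD, mul_zero]

/-- The inner operator sends `-9/2` to `-3 m_x`, whose threefold antiderivative of zero mean is `3(u
- μ(u))`. Adding `κ = 3 μ(u)` gives exactly `3u`, to which the outer operator is applied. -/
theorem J0_H0_eq {u : ℝ → ℝ} (hu : IsSmoothPeriodic u) (x : ℝ) :
    J0 (3 * mean u) (momentum u) (fun _ => -(9 / 2)) x
      = -u x * deriv (momentum u) x - 3 * deriv u x * momentum u x := by
  have hm := hu.momentum
  have e1 : innerOp (momentum u) (fun _ => -(9 / 2)) = fun x => -3 * deriv (momentum u) x := by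
    funext x; simp only [innerOp, deriv_const]; ring
  have e2 : invD (deriv (momentum u)) = momentum u := by
    symm
    refine hm.deriv.invD_unique (fun x => ?_) (mean_momentum hu)
    rw [hm.mean_deriv, sub_zero]
    exact hm.hasDerivAt x
  have e3 : invD^[3] (innerOp (momentum u) fun _ => -(9 / 2)) = fun x => -3 * (mean u - u x) := by
    change invD (invD (invD _)) = _
    rw [e1, invD_const_mul hm.deriv, e2, invD_const_mul hm, invD_const_mul hm.invD,
      invD2_momentum hu]
  have e4 : (fun y => invD^[3] (innerOp (momentum u) fun _ => -(9 / 2)) y + 3 * mean u)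
      = fun x => 3 * u x := by
    funext y; rw [e3]; ring
  have e5 : deriv (fun x => 3 * u x) x = 3 * deriv u x := ((hu.hasDerivAt x).const_mul 3).deriv
  unfold J0
  rw [e4]
  simp only [outerOp, e5]
  ring

theorem deriv2_mul_deriv {u : ℝ → ℝ} (hu : IsSmoothPeriodic u) :
    deriv (deriv (fun x => u x * deriv u x)) =
      fun x => 3 * deriv u x * iteratedDeriv 2 u x + u x * iteratedDeriv 3 u x := by
  have h2 : iteratedDeriv 2 u = deriv (deriv u) := by rw [iteratedDeriv_succ, iteratedDeriv_one]
  have h3 : iteratedDeriv 3 u = deriv (deriv (deriv u)) := by rw [iteratedDeriv_succ, h2]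
  have e1 : deriv (fun x => u x * deriv u x)
      = fun x => deriv u x * deriv u x + u x * deriv (deriv u) x :=
    funext fun x => ((hu.hasDerivAt x).mul (hu.deriv.hasDerivAt x)).deriv
  rw [e1, h2, h3]
  funext x
  refine (((hu.deriv.hasDerivAt x).mul (hu.deriv.hasDerivAt x)).add
    ((hu.hasDerivAt x).mul (hu.deriv.deriv.hasDerivAt x))).deriv.trans ?_
  ring

/-- Two of the five derivatives undo `∂_x⁻²` and the third removes the mean, which leaves `(u
u_x)_xx`. -/
theorem J2_H2_eq {u : ℝ → ℝ} (hu : IsSmoothPeriodic u) (x : ℝ) :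
    J2 (momentum u) (fun x => 1 / 2 * invD^[2] (fun y => velocity (mean u) (momentum u) y *
      velocity (mean u) (momentum u) y) x) x
      = -u x * deriv (momentum u) x - 3 * deriv u x * momentum u x := by
  have hw := hu.mul hu
  have e0 : deriv (momentum u) x = -iteratedDeriv 3 u x := by
    rw [iteratedDeriv_succ]; exact ((hu.iteratedDeriv 2).hasDerivAt x).neg.deriv
  rw [velocity_momentum hu]
  unfold J2
  change iteratedDeriv 5 (fun x => 1 / 2 * invD (invD fun y => u y * u y) x) x = _
  have e1 : deriv (fun x => 1 / 2 * invD (invD fun y => u y * u y) x)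
      = fun x => 1 / 2 * invD (fun y => u y * u y) x := funext fun x => by
    have := (hw.invD.invD_hasDerivAt x).const_mul (1 / 2)
    rw [hw.mean_invD, sub_zero] at this
    exact this.deriv
  have e2 : deriv (fun x => 1 / 2 * invD (fun y => u y * u y) x)
      = fun x => 1 / 2 * (u x * u x - mean fun y => u y * u y) := funext fun x =>
    ((hw.invD_hasDerivAt x).const_mul (1 / 2)).deriv
  have e3 : deriv (fun x => 1 / 2 * (u x * u x - mean fun y => u y * u y))
      = fun x => u x * deriv u x := funext fun x => by
    refine ((((hu.hasDerivAt x).mul (hu.hasDerivAt x)).sub_const _).const_mul (1 / 2)).deriv.trans ?_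
    ring
  rw [iteratedDeriv_succ', e1, iteratedDeriv_succ', e2, iteratedDeriv_succ', e3,
    iteratedDeriv_succ, iteratedDeriv_one, deriv2_mul_deriv hu, e0]
  unfold momentum
  ring

/-! ### Calculus on the half-open time strip -/

/-- `v` is smooth on `[0, T) × ℝ`. -/
def SmoothOnStrip (T : ℝ) (v : ℝ → ℝ → ℝ) : Prop :=
  ContDiffOn ℝ ∞ (fun p : ℝ × ℝ => v p.1 p.2) (Ico 0 T ×ˢ univ)

section Strip

variable {T : ℝ} {v : ℝ → ℝ → ℝ} {t : ℝ}

theorem uniqueDiffOn_Ico_zero (T : ℝ) : UniqueDiffOn ℝ (Ico 0 T) := uniqueDiffOn_Ico 0 T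

theorem uniqueDiffOn_strip (T : ℝ) : UniqueDiffOn ℝ (Ico 0 T ×ˢ (univ : Set ℝ)) :=
  (uniqueDiffOn_Ico 0 T).prod uniqueDiffOn_univ

theorem SmoothOnStrip.hasFDerivWithinAt (hv : SmoothOnStrip T v) (ht : t ∈ Ico 0 T) (x : ℝ) :
    HasFDerivWithinAt (fun p : ℝ × ℝ => v p.1 p.2)
      (fderivWithin ℝ (fun p : ℝ × ℝ => v p.1 p.2) (Ico 0 T ×ˢ univ) (t, x))
      (Ico 0 T ×ˢ univ) (t, x) :=
  (hv.differentiableOn (by simp) (t, x) ⟨ht, mem_univ x⟩).hasFDerivWithinAt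

theorem SmoothOnStrip.slice (hv : SmoothOnStrip T v) (ht : t ∈ Ico 0 T) : ContDiff ℝ ∞ (v t) := by
  rw [← contDiffOn_univ]
  exact ContDiffOn.comp (t := Ico 0 T ×ˢ univ) hv
    (by fun_prop : ContDiff ℝ ∞ fun x : ℝ => (t, x)).contDiffOn fun x _ => ⟨ht, mem_univ x⟩

theorem SmoothOnStrip.deriv_eq (hv : SmoothOnStrip T v) (ht : t ∈ Ico 0 T) (x : ℝ) :
    deriv (v t) x
      = fderivWithin ℝ (fun p : ℝ × ℝ => v p.1 p.2) (Ico 0 T ×ˢ univ) (t, x) (0, 1) := by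
  have h := (hv.hasFDerivWithinAt ht x).comp_hasDerivWithinAt x (s := univ)
    ((hasDerivAt_const x t).prodMk (hasDerivAt_id x)).hasDerivWithinAt
    fun y _ => ⟨ht, mem_univ y⟩
  rw [hasDerivWithinAt_univ] at h
  exact h.deriv

theorem mapsTo_strip (T : ℝ) (X : ℝ → ℝ) :
    MapsTo (fun s => (s, X s)) (Ico 0 T) (Ico 0 T ×ˢ (univ : Set ℝ)) :=
  fun s hs => ⟨hs, mem_univ (X s)⟩

theorem SmoothOnStrip.timeDeriv_eq (hv : SmoothOnStrip T v) (ht : t ∈ Ico 0 T) (x : ℝ) :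
    timeDeriv T v t x
      = fderivWithin ℝ (fun p : ℝ × ℝ => v p.1 p.2) (Ico 0 T ×ˢ univ) (t, x) (1, 0) := by
  have h := (hv.hasFDerivWithinAt ht x).comp_hasDerivWithinAt t
    ((hasDerivWithinAt_id t _).prodMk (hasDerivWithinAt_const t _ x)) (mapsTo_strip T fun _ => x)
  exact h.derivWithin (uniqueDiffOn_Ico_zero T t ht)

/-- The chain rule along a curve `s ↦ (s, X s)`. -/
theorem SmoothOnStrip.hasDerivWithinAt_along (hv : SmoothOnStrip T v) (ht : t ∈ Ico 0 T)
    {X : ℝ → ℝ} {X' : ℝ} (hX : HasDerivWithinAt X X' (Ico 0 T) t) :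
    HasDerivWithinAt (fun s => v s (X s)) (timeDeriv T v t (X t) + deriv (v t) (X t) * X')
      (Ico 0 T) t := by
  have h2 := (hv.hasFDerivWithinAt ht (X t)).comp_hasDerivWithinAt t
    ((hasDerivWithinAt_id t _).prodMk hX) (mapsTo_strip T X)
  refine h2.congr_deriv ?_
  have e : ((1, X') : ℝ × ℝ) = (1, 0) + X' • (0, 1) := by simp
  rw [hv.timeDeriv_eq ht, hv.deriv_eq ht, e, map_add, map_smul, smul_eq_mul, mul_comm X']

theorem SmoothOnStrip.deriv (hv : SmoothOnStrip T v) : SmoothOnStrip T (fun s => deriv (v s)) := by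
  have h := (hv.fderivWithin (m := ∞) (uniqueDiffOn_strip T) (by simp)).clm_apply
    (contDiffOn_const (c := ((0, 1) : ℝ × ℝ)))
  exact h.congr fun p hp => hv.deriv_eq hp.1 p.2

theorem SmoothOnStrip.timeDeriv (hv : SmoothOnStrip T v) : SmoothOnStrip T (timeDeriv T v) := by
  have h := (hv.fderivWithin (m := ∞) (uniqueDiffOn_strip T) (by simp)).clm_apply
    (contDiffOn_const (c := ((1, 0) : ℝ × ℝ)))
  exact h.congr fun p hp => hv.timeDeriv_eq hp.1 p.2

theorem SmoothOnStrip.deriv_timeDeriv (hv : SmoothOnStrip T v) (ht : t ∈ Ico 0 T) (x : ℝ) :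
    _root_.deriv (MuBurgers.timeDeriv T v t) x = MuBurgers.timeDeriv T (fun s => _root_.deriv (v s)) t x := by
  set S : Set (ℝ × ℝ) := Ico 0 T ×ˢ univ with hS
  have hp : (t, x) ∈ S := ⟨ht, mem_univ x⟩
  have hu : UniqueDiffWithinAt ℝ S (t, x) := uniqueDiffOn_strip T _ hp
  have hD : DifferentiableWithinAt ℝ (fderivWithin ℝ (fun p : ℝ × ℝ => v p.1 p.2) S) S (t, x) :=
    (hv.fderivWithin (m := ∞) (uniqueDiffOn_strip T) (by simp)).differentiableOn (by simp) _ hp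
  have key : ∀ e : ℝ × ℝ, ∀ w : ℝ → ℝ → ℝ,
      (∀ p ∈ S, w p.1 p.2 = fderivWithin ℝ (fun p : ℝ × ℝ => v p.1 p.2) S p e) → ∀ e',
      fderivWithin ℝ (fun p : ℝ × ℝ => w p.1 p.2) S (t, x) e'
        = fderivWithin ℝ (fderivWithin ℝ (fun p : ℝ × ℝ => v p.1 p.2) S) S (t, x) e' e := by
    intro e w hw e'
    rw [fderivWithin_congr (fun p hp => hw p hp) (hw _ hp),
      fderivWithin_clm_apply hu hD (differentiableWithinAt_const e)]
    simp
  rw [hv.timeDeriv.deriv_eq ht, hv.deriv.timeDeriv_eq ht]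
  refine (key (1, 0) (MuBurgers.timeDeriv T v) (fun p hp => hv.timeDeriv_eq hp.1 p.2) (0, 1)).trans
    (Eq.trans ?_ (key (0, 1) (fun s => _root_.deriv (v s))
      (fun p hp => hv.deriv_eq hp.1 p.2) (1, 0)).symm)
  -- At `t = 0` the point lies on the boundary of the strip; symmetry of the second derivative
  -- within the set still holds in the closure of the interior.
  have hcl : (t, x) ∈ closure (interior S) := by
    rw [hS, interior_prod_eq, interior_Ico, closure_prod_eq, closure_Ioo (ht.1.trans_lt ht.2).ne]
    simpa using ⟨ht.1, ht.2.le⟩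
  exact (hv.contDiffWithinAt hp).isSymmSndFDerivWithinAt (by
    rw [minSmoothness_of_isRCLikeNormedField]
    exact WithTop.coe_le_coe.2 (le_top : (2 : ℕ∞) ≤ ⊤)) (uniqueDiffOn_strip T) hcl hp _ _

theorem SmoothOnStrip.timeDeriv_momentum (hv : SmoothOnStrip T v) (ht : t ∈ Ico 0 T) (x : ℝ) :
    MuBurgers.timeDeriv T (fun s => momentum (v s)) t x
      = -iteratedDeriv 2 (MuBurgers.timeDeriv T v t) x := by
  have e : _root_.deriv (MuBurgers.timeDeriv T v t) = MuBurgers.timeDeriv T (fun s => _root_.deriv (v s)) t :=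
    funext fun y => hv.deriv_timeDeriv ht y
  rw [iteratedDeriv_succ, iteratedDeriv_one, e, hv.deriv.deriv_timeDeriv ht]
  unfold MuBurgers.timeDeriv
  simp only [momentum_eq]
  exact derivWithin.fun_neg

end Strip

/-! ### The μB equation in momentum form and in Burgers form -/

theorem IsSmoothCurve.strip {T : ℝ} {u : ℝ → ℝ → ℝ} (hu : IsSmoothCurve T u) : SmoothOnStrip T u :=
  hu.2.1

theorem IsSmoothCurve.slice {T : ℝ} {u : ℝ → ℝ → ℝ} (hu : IsSmoothCurve T u) {t : ℝ}
    (ht : t ∈ Ico 0 T) : IsSmoothPeriodic (u t) := ⟨hu.strip.slice ht, hu.2.2 t ht⟩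

theorem IsSmoothCurve.isMuBSolution_iff {T : ℝ} {u : ℝ → ℝ → ℝ} (hu : IsSmoothCurve T u) :
    IsMuBSolution T u ↔ ∀ t ∈ Ico 0 T, ∀ x : ℝ, timeDeriv T (fun s => momentum (u s)) t x
      = -u t x * deriv (momentum (u t)) x - 3 * deriv (u t) x * momentum (u t) x := by
  unfold IsMuBSolution
  rw [and_iff_right hu]
  refine forall₂_congr fun t ht => forall_congr' fun x => ?_
  have e0 : deriv (momentum (u t)) x = -iteratedDeriv 3 (u t) x := by
    rw [iteratedDeriv_succ]; exact (((hu.slice ht).iteratedDeriv 2).hasDerivAt x).neg.deriv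
  rw [hu.strip.timeDeriv_momentum ht, e0, momentum]
  constructor <;> intro h <;> linarith

theorem hasDerivWithinAt_primitive {g : ℝ → ℝ} {T t : ℝ} (hg : ContinuousOn g (Ico 0 T))
    (ht : t ∈ Ico 0 T) :
    HasDerivWithinAt (fun t => ∫ s in (0 : ℝ)..t, g s) (g t) (Ico 0 T) t := by
  obtain ⟨t₁, ht₁, h₁T⟩ := exists_between ht.2
  -- Clamping time to `[0, t₁]` gives a function continuous on all of `ℝ` with the same primitive
  -- near `t`.
  let h : ℝ → ℝ := fun s => g (max 0 (min s t₁))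
  have h0 : 0 ≤ t₁ := ht.1.trans ht₁.le
  have hc : Continuous h := hg.comp_continuous (by fun_prop) fun s =>
    ⟨le_max_left _ _, max_lt (h0.trans_lt h₁T) ((min_le_right _ _).trans_lt h₁T)⟩
  have heq : ∀ s ∈ Icc 0 t₁, h s = g s := fun s hs => by
    simp only [h]; rw [min_eq_left hs.2, max_eq_right hs.1]
  have hd := (hc.integral_hasStrictDerivAt 0 t).hasDerivAt.hasDerivWithinAt (s := Ico 0 T)
  rw [heq t ⟨ht.1, ht₁.le⟩] at hd
  have hint : ∀ s ∈ Icc 0 t₁, ∫ σ in (0 : ℝ)..s, g σ = ∫ σ in (0 : ℝ)..s, h σ := fun s hs => by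
    refine intervalIntegral.integral_congr fun σ hσ => ?_
    rw [uIcc_of_le hs.1] at hσ
    exact (heq σ ⟨hσ.1, hσ.2.trans hs.2⟩).symm
  refine hd.congr_of_eventuallyEq ?_ (hint t ⟨ht.1, ht₁.le⟩)
  filter_upwards [self_mem_nhdsWithin, mem_nhdsWithin_of_mem_nhds (gt_mem_nhds ht₁)] with s hs hs'
  exact hint s ⟨hs.1, le_of_lt hs'⟩

/-- A linear homogeneous differential equation has only the zero solution with zero initial value. -/
theorem eq_zero_of_hasDerivWithinAt_linear {φ k : ℝ → ℝ} {T : ℝ} (hk : ContinuousOn k (Ico 0 T))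
    (hφ : ∀ t ∈ Ico 0 T, HasDerivWithinAt φ (-k t * φ t) (Ico 0 T) t) (h0 : φ 0 = 0) :
    ∀ t ∈ Ico 0 T, φ t = 0 := by
  intro t ht
  have hd : ∀ s ∈ Ico 0 T, HasDerivWithinAt
      (fun s => φ s * Real.exp (∫ σ in (0 : ℝ)..s, k σ)) 0 (Ico 0 T) s := fun s hs => by
    refine ((hφ s hs).mul (hasDerivWithinAt_primitive hk hs).exp).congr_deriv ?_
    ring
  have h := (convex_Ico 0 T).norm_image_sub_le_of_norm_hasDerivWithin_le hd
    (fun s _ => norm_zero.le) ⟨le_rfl, ht.1.trans_lt ht.2⟩ ht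
  simp only [h0, zero_mul, sub_zero, norm_le_zero_iff] at h
  exact (mul_eq_zero.1 h).resolve_right (Real.exp_ne_zero _)

theorem IsMuBSolution.curve {T : ℝ} {u : ℝ → ℝ → ℝ} (h : IsMuBSolution T u) : IsSmoothCurve T u :=
  h.1

theorem IsSmoothPeriodic.eq_const_of_deriv2 {w : ℝ → ℝ} (hw : IsSmoothPeriodic w)
    (h : ∀ x, _root_.deriv (_root_.deriv w) x = 0) (x : ℝ) : w x = w 0 := by
  have h1 : ∀ x, _root_.deriv w x = _root_.deriv w 0 := fun x =>
    is_const_of_deriv_eq_zero hw.deriv.differentiable h x 0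
  have h2 := hw.mean_deriv
  rw [funext h1, mean_const] at h2
  exact is_const_of_deriv_eq_zero hw.differentiable (fun x => (h1 x).trans h2) x 0

theorem timeDeriv_periodic {T : ℝ} {u : ℝ → ℝ → ℝ} (hu : IsSmoothCurve T u) {t : ℝ}
    (ht : t ∈ Ico 0 T) : Function.Periodic (timeDeriv T u t) 1 := fun x =>
  derivWithin_congr (fun s hs => hu.2.2 s hs x) (hu.2.2 t ht x)

theorem IsSmoothCurve.timeDeriv_slice {T : ℝ} {u : ℝ → ℝ → ℝ} (hu : IsSmoothCurve T u) {t : ℝ}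
    (ht : t ∈ Ico 0 T) : IsSmoothPeriodic (timeDeriv T u t) :=
  ⟨hu.strip.timeDeriv.slice ht, timeDeriv_periodic hu ht⟩

theorem deriv2_add {f g : ℝ → ℝ} (hf : IsSmoothPeriodic f) (hg : IsSmoothPeriodic g) :
    deriv (deriv (fun x => f x + g x)) = fun x => deriv (deriv f) x + deriv (deriv g) x := by
  have e : deriv (fun x => f x + g x) = fun x => deriv f x + deriv g x :=
    funext fun x => ((hf.hasDerivAt x).add (hg.hasDerivAt x)).deriv
  rw [e]
  exact funext fun x => ((hf.deriv.hasDerivAt x).add (hg.deriv.hasDerivAt x)).deriv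

/-- The μB equation says that `u_t + u u_x` does not depend on `x`. -/
theorem IsSmoothCurve.isMuBSolution_iff_burgers {T : ℝ} {u : ℝ → ℝ → ℝ} (hu : IsSmoothCurve T u) :
    IsMuBSolution T u ↔ ∀ t ∈ Ico 0 T, ∀ x, timeDeriv T u t x + u t x * deriv (u t) x
      = timeDeriv T u t 0 + u t 0 * deriv (u t) 0 := by
  unfold IsMuBSolution
  rw [and_iff_right hu]
  refine forall₂_congr fun t ht => ?_
  have sut := hu.timeDeriv_slice ht
  have su := hu.slice ht
  have hdd := deriv2_add sut (su.mul su.deriv)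
  rw [deriv2_mul_deriv su] at hdd
  have e : ∀ x, deriv (deriv (fun x => timeDeriv T u t x + u t x * deriv (u t) x)) x
      = iteratedDeriv 2 (timeDeriv T u t) x + 3 * deriv (u t) x * iteratedDeriv 2 (u t) x
      + u t x * iteratedDeriv 3 (u t) x := fun x => by
    rw [hdd, iteratedDeriv_succ (n := 1) (f := timeDeriv T u t), iteratedDeriv_one]; ring
  simp only [← e]
  refine ⟨fun h x => (sut.add (su.mul su.deriv)).eq_const_of_deriv2 h x, fun h x => ?_⟩
  rw [funext h]
  simp

/-! ### Characteristics and conserved integrals -/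

section Solution

variable {T : ℝ} {u : ℝ → ℝ → ℝ}

/-- The characteristic map increases by one over a period, so the change of variables holds without
monotonicity or injectivity. -/
theorem IsSmoothPeriodic.integral_comp_mul_deriv {Φ v : ℝ → ℝ} (hΦ : Continuous Φ)
    (hper : Function.Periodic Φ 1) (hv : IsSmoothPeriodic v) (t n : ℝ) :
    ∫ y in (0 : ℝ)..1, Φ (y + t * v y + n) * (1 + t * _root_.deriv v y) = mean Φ := by
  have hX : ∀ y, HasDerivAt (fun y => y + t * v y + n) (1 + t * _root_.deriv v y) y := fun y =>
    ((hasDerivAt_id y).add ((hv.hasDerivAt y).const_mul t)).add_const n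
  have h := intervalIntegral.integral_comp_mul_deriv (a := 0) (b := 1) (fun y _ => hX y)
    (continuous_const.add (hv.deriv.continuous.const_mul t)).continuousOn hΦ
  refine h.trans ?_
  have e : (1 : ℝ) + t * v 1 + n = (0 + t * v 0 + n) + 1 := by
    have := hv.2 0
    rw [zero_add] at this
    rw [this]; ring
  rw [e, hper.intervalIntegral_add_eq _ 0, zero_add]
  rfl

/-- The additional term `t v^p v'` is the derivative of the periodic function `t v^{p+1} / (p+1)`.
-/
theorem IsSmoothPeriodic.integral_pow_mul_deriv {v : ℝ → ℝ} (hv : IsSmoothPeriodic v) (p : ℕ)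
    (t : ℝ) : ∫ y in (0 : ℝ)..1, v y ^ p * (1 + t * _root_.deriv v y) = ∫ y in (0 : ℝ)..1, v y ^ p := by
  have hc := hv.continuous
  have hc' := hv.deriv.continuous
  have h1 : mean (fun y => v y ^ p * (t * _root_.deriv v y)) = 0 := by
    refine mean_eq_zero_of_hasDerivAt (W := fun y => t / (p + 1) * v y ^ (p + 1)) (fun y => ?_)
      (by fun_prop) ?_
    · refine (((hv.hasDerivAt y).pow (p + 1)).const_mul (t / (p + 1))).congr_deriv ?_
      have : (p : ℝ) + 1 ≠ 0 := by positivity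
      push_cast
      field_simp
    · have := hv.2 0
      rw [zero_add] at this
      rw [this]
  simp only [mul_add, mul_one]
  rw [intervalIntegral.integral_add (Continuous.intervalIntegrable (by fun_prop) _ _)
    (Continuous.intervalIntegrable (by fun_prop) _ _)]
  change _ + mean _ = _
  rw [h1, add_zero]

/-- Solutions along characteristics, in terms of some function `ν` of time. -/
theorem IsMuBSolution.exists_characteristics (h : IsMuBSolution T u) :
    ∃ ν : ℝ → ℝ, ContinuousOn ν (Ico 0 T) ∧ ∀ t ∈ Ico 0 T, ∀ y,
      u t (y + t * (u 0 y - mean (u 0)) + ∫ s in (0 : ℝ)..t, ν s) = u 0 y - mean (u 0) + ν t := by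
  have hu := h.curve
  have hB := hu.isMuBSolution_iff_burgers.1 h
  let g : ℝ → ℝ := fun t => timeDeriv T u t 0 + u t 0 * deriv (u t) 0
  have hcurve : ∀ {w : ℝ → ℝ → ℝ}, SmoothOnStrip T w → ∀ {X : ℝ → ℝ}, ContinuousOn X (Ico 0 T) →
      ContinuousOn (fun t => w t (X t)) (Ico 0 T) := fun {w} hw {X} hX =>
    ContinuousOn.comp (t := Ico 0 T ×ˢ univ) hw.continuousOn (continuousOn_id.prodMk hX)
      (mapsTo_strip T X)
  have hg : ContinuousOn g (Ico 0 T) :=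
    (hcurve hu.strip.timeDeriv continuousOn_const).add
      ((hcurve hu.strip continuousOn_const).mul (hcurve hu.strip.deriv continuousOn_const))
  let ν : ℝ → ℝ := fun t => mean (u 0) + ∫ s in (0 : ℝ)..t, g s
  have hν : ∀ t ∈ Ico 0 T, HasDerivWithinAt ν (g t) (Ico 0 T) t := fun t ht =>
    (hasDerivWithinAt_primitive hg ht).const_add _
  have hνc : ContinuousOn ν (Ico 0 T) := fun t ht => (hν t ht).continuousWithinAt
  refine ⟨ν, hνc, fun t ht y => ?_⟩
  set v := u 0 y - mean (u 0) with hv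
  let X : ℝ → ℝ := fun t => y + t * v + ∫ s in (0 : ℝ)..t, ν s
  have hX : ∀ t ∈ Ico 0 T, HasDerivWithinAt X (v + ν t) (Ico 0 T) t := fun t ht => by
    refine ((((hasDerivWithinAt_id t _).mul_const v).const_add y).add
      (hasDerivWithinAt_primitive hνc ht)).congr_deriv ?_
    simp
  have hXc : ContinuousOn X (Ico 0 T) := fun t ht => (hX t ht).continuousWithinAt
  -- The curve `X` is defined explicitly rather than by solving `X' = u`. The defect `φ = u(t, X) -
  -- ν - v` then satisfies `φ' = -u_x(t, X) φ` and starts at zero.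
  have := eq_zero_of_hasDerivWithinAt_linear (φ := fun t => u t (X t) - ν t - v)
    (k := fun t => deriv (u t) (X t)) (hcurve hu.strip.deriv hXc) (fun t ht => by
      refine (((hu.strip.hasDerivWithinAt_along ht (hX t ht)).sub (hν t ht)).sub_const v).congr_deriv ?_
      simp only [g]
      rw [← hB t ht (X t)]
      ring) (by simp [X, ν, hv]) t ht
  simp only [X] at this
  linarith

theorem IsMuBSolution.zero_mem (h : IsMuBSolution T u) : (0 : ℝ) ∈ Ico 0 T := ⟨le_rfl, h.1.1⟩

theorem IsMuBSolution.initial (h : IsMuBSolution T u) :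
    IsSmoothPeriodic (fun y => u 0 y - mean (u 0)) :=
  (h.curve.slice h.zero_mem).sub (IsSmoothPeriodic.const _)

/-- Solutions of μB along characteristics. -/
theorem IsMuBSolution.characteristics (h : IsMuBSolution T u) {t : ℝ} (ht : t ∈ Ico 0 T) (y : ℝ) :
    u t (y + t * (u 0 y - mean (u 0)) + ∫ s in (0 : ℝ)..t, mean (u s))
      = u 0 y - mean (u 0) + mean (u t) := by
  obtain ⟨ν, -, hν⟩ := h.exists_characteristics
  -- The first moment identifies `ν`: the function `u - ν` has the mean of `v`, which is zero.
  have hmean : ∀ t ∈ Ico 0 T, mean (u t) = ν t := fun t ht => by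
    have su := (h.curve.slice ht).sub (IsSmoothPeriodic.const (ν t))
    have h1 := h.initial.integral_comp_mul_deriv su.continuous su.2 t (∫ s in (0 : ℝ)..t, ν s)
    simp only [hν t ht, add_sub_cancel_right] at h1
    have h2 := h.initial.integral_pow_mul_deriv 1 t
    simp only [pow_one] at h2
    rw [h2] at h1
    have h3 := mean_sub (h.curve.slice h.zero_mem) (IsSmoothPeriodic.const (mean (u 0)))
    rw [mean_const, sub_self] at h3
    rw [mean_sub (h.curve.slice ht) (IsSmoothPeriodic.const (ν t)), mean_const] at h1
    unfold mean at h1 h3 ⊢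
    linarith
  rw [hmean t ht, ← hν t ht y]
  congr 2
  refine intervalIntegral.integral_congr fun s hs => ?_
  rw [uIcc_of_le ht.1] at hs
  exact hmean s ⟨hs.1, hs.2.trans_lt ht.2⟩

theorem IsMuBSolution.integral_pow (h : IsMuBSolution T u) (p : ℕ) {t : ℝ} (ht : t ∈ Ico 0 T) :
    ∫ x in (0 : ℝ)..1, (u t x - mean (u t)) ^ p = ∫ x in (0 : ℝ)..1, (u 0 x - mean (u 0)) ^ p := by
  have su := (h.curve.slice ht).sub (IsSmoothPeriodic.const (mean (u t)))
  have h1 := h.initial.integral_comp_mul_deriv (Φ := fun x => (u t x - mean (u t)) ^ p)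
    (su.continuous.pow p)
    (fun x => congrArg (· ^ p) (su.2 x)) t (∫ s in (0 : ℝ)..t, mean (u s))
  simp only [h.characteristics ht, add_sub_cancel_right] at h1
  rw [h.initial.integral_pow_mul_deriv p t] at h1
  exact h1.symm

theorem IsMuBSolution.deriv_characteristics (h : IsMuBSolution T u) {t : ℝ} (ht : t ∈ Ico 0 T)
    (y : ℝ) : deriv (u t) (y + t * (u 0 y - mean (u 0)) + ∫ s in (0 : ℝ)..t, mean (u s))
      * (1 + t * deriv (u 0) y) = deriv (u 0) y := by
  have h0 := (h.curve.slice h.zero_mem).hasDerivAt y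
  have hX : HasDerivAt (fun y => y + t * (u 0 y - mean (u 0)) + ∫ s in (0 : ℝ)..t, mean (u s))
      (1 + t * deriv (u 0) y) y :=
    ((hasDerivAt_id y).add ((h0.sub_const _).const_mul t)).add_const _
  have h1 := ((h.curve.slice ht).hasDerivAt _).comp y hX
  have e : u t ∘ (fun y => y + t * (u 0 y - mean (u 0)) + ∫ s in (0 : ℝ)..t, mean (u s))
      = fun y => u 0 y - mean (u 0) + mean (u t) := funext fun y => h.characteristics ht y
  rw [e] at h1
  exact h1.unique ((h0.sub_const _).add_const _)

end Solution

theorem IsSmoothPeriodic.exists_le {f : ℝ → ℝ} (hf : IsSmoothPeriodic f) :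
    ∃ x₀, ∀ x, f x ≤ f x₀ := by
  obtain ⟨x₀, -, hx₀⟩ := (isCompact_Icc (a := (0 : ℝ)) (b := 1)).exists_isMaxOn
    ⟨0, by simp⟩ hf.continuous.continuousOn
  refine ⟨x₀, fun x => ?_⟩
  obtain ⟨y, hy, hxy⟩ := hf.2.exists_mem_Ico₀ one_pos x
  rw [hxy]
  exact hx₀ ⟨hy.1, hy.2.le⟩

theorem IsSmoothPeriodic.const_of_deriv_nonneg {f : ℝ → ℝ} (hf : IsSmoothPeriodic f)
    (h : ∀ x, 0 ≤ _root_.deriv f x) : ∃ a, ∀ x, f x = a := by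
  have hmono := monotone_of_deriv_nonneg hf.differentiable h
  have hle : ∀ x y, f x ≤ f y := fun x y => by
    obtain ⟨n, hn⟩ := exists_nat_ge (x - y)
    have hper := hf.2.nat_mul n y
    rw [mul_one] at hper
    rw [← hper]
    exact hmono (by linarith)
  exact ⟨f 0, fun x => le_antisymm (hle x 0) (hle 0 x)⟩

/-! ### Inverting the characteristic map -/

section Flow

variable {v : ℝ → ℝ} {t : ℝ}

theorem IsSmoothPeriodic.hasDerivAt_flow (hv : IsSmoothPeriodic v) (t y : ℝ) :
    HasDerivAt (fun y => y + t * v y) (1 + t * _root_.deriv v y) y :=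
  (hasDerivAt_id y).add ((hv.hasDerivAt y).const_mul t)

theorem IsSmoothPeriodic.surjective_flow (hv : IsSmoothPeriodic v) (t : ℝ) :
    Function.Surjective (fun y => y + t * v y) := by
  obtain ⟨x₁, h₁⟩ := (hv.const_mul t).exists_le
  obtain ⟨x₂, h₂⟩ := (hv.const_mul t).neg.exists_le
  refine Continuous.surjective (continuous_id.add (hv.continuous.const_mul t)) ?_ ?_
  · exact tendsto_atTop_add_right_of_le _ (t * v x₂) tendsto_id fun y => by linarith [h₂ y]
  · exact tendsto_atBot_add_right_of_ge _ (t * v x₁) tendsto_id fun y => h₁ y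

theorem IsSmoothPeriodic.injective_flow (hv : IsSmoothPeriodic v)
    (h : ∀ y, 0 < 1 + t * _root_.deriv v y) : Function.Injective (fun y => y + t * v y) :=
  (strictMono_of_deriv_pos fun y => by rw [(hv.hasDerivAt_flow t y).deriv]; exact h y).injective

/-- The inverse of the map `y ↦ y + t v(y)`. -/
noncomputable def invFlow (v : ℝ → ℝ) (p : ℝ × ℝ) : ℝ :=
  Function.invFun (fun y => y + p.1 * v y) p.2

theorem IsSmoothPeriodic.flow_invFlow (hv : IsSmoothPeriodic v) (t z : ℝ) :
    invFlow v (t, z) + t * v (invFlow v (t, z)) = z :=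
  Function.invFun_eq (hv.surjective_flow t z)

theorem IsSmoothPeriodic.invFlow_eq (hv : IsSmoothPeriodic v)
    (h : ∀ y, 0 < 1 + t * _root_.deriv v y) {y z : ℝ} (hy : y + t * v y = z) :
    invFlow v (t, z) = y :=
  hv.injective_flow h (by simpa only [hy] using hv.flow_invFlow t z)

theorem IsSmoothPeriodic.contDiffAt_invFlow (hv : IsSmoothPeriodic v) {t₀ : ℝ}
    (h : ∀ᶠ t in 𝓝 t₀, ∀ y, 0 < 1 + t * _root_.deriv v y) (z₀ : ℝ) :
    ContDiffAt ℝ ∞ (invFlow v) (t₀, z₀) := by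
  -- Time is kept as a coordinate so that the inverse function theorem gives joint smoothness.
  -- Injectivity at nearby times identifies the local inverse with the global one.
  let Φ : ℝ × ℝ → ℝ × ℝ := fun p => (p.1, p.2 + p.1 * v p.2)
  set y₀ := invFlow v (t₀, z₀) with hy₀
  have hΦ : ContDiff ℝ ∞ Φ :=
    contDiff_fst.prodMk (contDiff_snd.add (contDiff_fst.mul (hv.1.comp contDiff_snd)))
  have hΦ₀ : Φ (t₀, y₀) = (t₀, z₀) := Prod.ext rfl (hv.flow_invFlow t₀ z₀)
  set d := 1 + t₀ * _root_.deriv v y₀ with hd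
  have hd0 : d ≠ 0 := (h.self_of_nhds y₀).ne'
  let L : (ℝ × ℝ) ≃L[ℝ] (ℝ × ℝ) := ContinuousLinearEquiv.equivOfInverse
    ((ContinuousLinearMap.fst ℝ ℝ ℝ).prod
      (v y₀ • ContinuousLinearMap.fst ℝ ℝ ℝ + d • ContinuousLinearMap.snd ℝ ℝ ℝ))
    ((ContinuousLinearMap.fst ℝ ℝ ℝ).prod
      (d⁻¹ • (ContinuousLinearMap.snd ℝ ℝ ℝ - v y₀ • ContinuousLinearMap.fst ℝ ℝ ℝ)))
    (fun p => by ext <;> simp [hd0]) (fun p => by ext <;> simp [hd0])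
  have hL : HasFDerivAt Φ (L : (ℝ × ℝ) →L[ℝ] (ℝ × ℝ)) (t₀, y₀) := by
    have h1 : HasFDerivAt (fun p : ℝ × ℝ => v p.2)
        (_root_.deriv v y₀ • ContinuousLinearMap.snd ℝ ℝ ℝ) (t₀, y₀) :=
      HasDerivAt.comp_hasFDerivAt (h₂ := v) (f := Prod.snd) (t₀, y₀) (hv.hasDerivAt y₀) hasFDerivAt_snd
    refine (hasFDerivAt_fst.prodMk (hasFDerivAt_snd.add (hasFDerivAt_fst.mul h1))).congr_fderiv ?_
    ext <;> simp [L, hd]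
  have hn : (∞ : WithTop ℕ∞) ≠ 0 := by simp
  have hcd := hΦ.contDiffAt.to_localInverse hL hn
  rw [hΦ₀] at hcd
  have hstrict := hΦ.contDiffAt.hasStrictFDerivAt' hL hn
  have hri := hstrict.eventually_right_inverse
  rw [hΦ₀] at hri
  have ht : ∀ᶠ q : ℝ × ℝ in 𝓝 (t₀, z₀), ∀ y, 0 < 1 + q.1 * _root_.deriv v y :=
    (continuous_fst.tendsto (t₀, z₀)).eventually h
  refine (contDiff_snd.contDiffAt.comp _ hcd).congr_of_eventuallyEq ?_
  filter_upwards [hri, ht] with q hq hqt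
  obtain ⟨h1, h2⟩ := Prod.ext_iff.1 hq
  simp only [Φ] at h1 h2
  rw [h1] at h2
  exact hv.invFlow_eq hqt h2

end Flow

/-! ### Solutions with prescribed mean -/

section Extension

theorem contDiffOn_primitive {c : ℝ → ℝ} (hc : ContDiffOn ℝ ∞ c (Ici 0)) :
    ContDiffOn ℝ ∞ (fun t => ∫ s in (0 : ℝ)..t, c s) (Ici 0) ∧
      ∀ t ∈ Ici (0 : ℝ), HasDerivWithinAt (fun t => ∫ s in (0 : ℝ)..t, c s) (c t) (Ici 0) t := by
  have hd : ∀ t ∈ Ici (0 : ℝ),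
      HasDerivWithinAt (fun t => ∫ s in (0 : ℝ)..t, c s) (c t) (Ici 0) t := fun t ht => by
    have h1 : t ∈ Ico 0 (t + 1) := ⟨ht, lt_add_one t⟩
    have h2 := hasDerivWithinAt_primitive
      (hc.continuousOn.mono (Ico_subset_Ici_self : Ico 0 (t + 1) ⊆ Ici 0)) h1
    refine h2.mono_of_mem_nhdsWithin ?_
    rw [← Ici_inter_Iio]
    exact inter_mem self_mem_nhdsWithin (mem_nhdsWithin_of_mem_nhds (Iio_mem_nhds (lt_add_one t)))
  refine ⟨(contDiffOn_infty_iff_derivWithin (uniqueDiffOn_Ici 0)).2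
    ⟨fun t ht => (hd t ht).differentiableWithinAt, hc.congr fun t ht => ?_⟩, hd⟩
  exact (hd t ht).derivWithin (uniqueDiffOn_Ici 0 t ht)

/-- The solution of μB with initial value `v + c 0` and mean `c`. -/
noncomputable def burgersFlow (v c : ℝ → ℝ) (t x : ℝ) : ℝ :=
  c t + v (invFlow v (t, x - ∫ s in (0 : ℝ)..t, c s))

variable {v c : ℝ → ℝ} {T : ℝ}

theorem burgersFlow_eq (hv : IsSmoothPeriodic v) {t : ℝ} (h : ∀ y, 0 < 1 + t * deriv v y) (y : ℝ) :
    burgersFlow v c t (y + t * v y + ∫ s in (0 : ℝ)..t, c s) = v y + c t := by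
  unfold burgersFlow
  rw [add_sub_cancel_right, hv.invFlow_eq h rfl, add_comm]

/-- Along the characteristic from `y` the function equals `v(y) + c(t)`, which is also its speed;
differentiating in time gives `u_t + u u_x = c'`. Positivity is required on a two-sided
neighbourhood of each time, also of `t = 0`, for the inverse function theorem. -/
theorem isMuBSolution_burgersFlow (hv : IsSmoothPeriodic v) (hc : ContDiffOn ℝ ∞ c (Ici 0))
    (hT : 0 < T) (h : ∀ t ∈ Ico 0 T, ∀ᶠ s in 𝓝 t, ∀ y, 0 < 1 + s * deriv v y) :
    IsMuBSolution T (burgersFlow v c) := by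
  obtain ⟨hC, hCd⟩ := contDiffOn_primitive hc
  have hsmooth : IsSmoothCurve T (burgersFlow v c) := by
    refine ⟨hT, fun p hp => ?_, fun t ht x => ?_⟩
    · have hmaps : MapsTo Prod.fst (Ico 0 T ×ˢ (univ : Set ℝ)) (Ici 0) := fun q hq => hq.1.1
      have h1 : ContDiffWithinAt ℝ ∞ (fun p : ℝ × ℝ => c p.1) (Ico 0 T ×ˢ univ) p :=
        hc.comp contDiffOn_fst hmaps p hp
      have h2 : ContDiffWithinAt ℝ ∞ (fun p : ℝ × ℝ => (p.1, p.2 - ∫ s in (0 : ℝ)..p.1, c s))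
          (Ico 0 T ×ˢ univ) p :=
        contDiffWithinAt_fst.prodMk (contDiffWithinAt_snd.sub (hC.comp contDiffOn_fst hmaps p hp))
      have h3 := ContDiffAt.comp_contDiffWithinAt (g := invFlow v) p
        (hv.contDiffAt_invFlow (h p.1 hp.1) (p.2 - ∫ s in (0 : ℝ)..p.1, c s)) h2
      exact h1.add (hv.1.contDiffAt.comp_contDiffWithinAt p h3)
    · have ht' := (h t ht).self_of_nhds
      unfold burgersFlow
      have e : invFlow v (t, x + 1 - ∫ s in (0 : ℝ)..t, c s)
          = invFlow v (t, x - ∫ s in (0 : ℝ)..t, c s) + 1 := by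
        apply hv.invFlow_eq ht'
        rw [hv.2]
        linear_combination hv.flow_invFlow t (x - ∫ s in (0 : ℝ)..t, c s)
      rw [e, hv.2]
  refine hsmooth.isMuBSolution_iff_burgers.2 fun t ht => ?_
  have key : ∀ x, timeDeriv T (burgersFlow v c) t x
      + burgersFlow v c t x * deriv (burgersFlow v c t) x = derivWithin c (Ico 0 T) t := by
    intro x
    set y := invFlow v (t, x - ∫ s in (0 : ℝ)..t, c s) with hy
    have hx : y + t * v y + ∫ s in (0 : ℝ)..t, c s = x := by
      have := hv.flow_invFlow t (x - ∫ s in (0 : ℝ)..t, c s)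
      linarith
    have hX : HasDerivWithinAt (fun t => y + t * v y + ∫ s in (0 : ℝ)..t, c s) (v y + c t)
        (Ico 0 T) t := by
      refine ((((hasDerivWithinAt_id t _).mul_const (v y)).const_add y).add
        ((hCd t ht.1).mono Ico_subset_Ici_self)).congr_deriv ?_
      simp
    have hd := hsmooth.strip.hasDerivWithinAt_along ht hX
    have hcd : HasDerivWithinAt c (derivWithin c (Ico 0 T) t) (Ico 0 T) t :=
      ((hc.differentiableOn (by simp) t ht.1).mono Ico_subset_Ici_self).hasDerivWithinAt
    have he : ∀ s ∈ Ico 0 T, burgersFlow v c s (y + s * v y + ∫ σ in (0 : ℝ)..s, c σ)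
        = v y + c s := fun s hs => burgersFlow_eq hv (h s hs).self_of_nhds y
    have hd2 := (hcd.const_add (v y)).congr he (he t ht)
    have := (hd.derivWithin (uniqueDiffOn_Ico_zero T t ht)).symm.trans
      (hd2.derivWithin (uniqueDiffOn_Ico_zero T t ht))
    rw [← he t ht, hx] at this
    linarith
  intro x
  rw [key x, key 0]

end Extension

/-! ### Maximal time, blow-up of the slope, and extension -/

section BlowUp

variable {T : ℝ} {u : ℝ → ℝ → ℝ}

theorem IsMuBSolution.le_of_deriv_eq (h : IsMuBSolution T u) {a x₀ : ℝ} (ha : 0 < a)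
    (hx₀ : deriv (u 0) x₀ = -a) : T ≤ 1 / a := by
  by_contra! hlt
  -- At time `1/a` the factor `1 + t u₀'(x₀)` vanishes, although its product with `u_x` has to be
  -- `-a`.
  have h1 := h.deriv_characteristics (t := 1 / a) ⟨by positivity, hlt⟩ x₀
  rw [hx₀] at h1
  have : 1 + 1 / a * -a = 0 := by field_simp; ring
  rw [this, mul_zero] at h1
  linarith

theorem one_add_mul_pos_of_lt {a t q : ℝ} (ha : 0 < a) (ht0 : 0 ≤ t) (ht : t < 1 / a)
    (hq : -a ≤ q) : 0 < 1 + t * q := by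
  have h1 : t * a < 1 := (lt_div_iff₀ ha).1 ht
  nlinarith

/-- The slopes are `q / (1 + t q)` with `q = u₀'(y)`. Negative ones are at least `-a / (1 - t a)`,
attained at `q = -a`; nonnegative ones do not exceed `q ≤ P`. -/
theorem IsMuBSolution.supNorm_deriv (h : IsMuBSolution T u) {a P x₀ t : ℝ} (ha : 0 < a)
    (hx₀ : deriv (u 0) x₀ = -a) (hlow : ∀ x, -a ≤ deriv (u 0) x) (hup : ∀ x, deriv (u 0) x ≤ P)
    (ht : t ∈ Ico 0 T) (hta : t < 1 / a) (htP : P ≤ a / (1 - t * a)) :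
    supNorm (deriv (u t)) = a / (1 - t * a) := by
  have h1 : 0 < 1 - t * a := by have := (lt_div_iff₀ ha).1 hta; linarith
  have hb : ∀ x, |deriv (u t) x| ≤ a / (1 - t * a) := fun x => by
    obtain ⟨y, hy⟩ := h.initial.surjective_flow t (x - ∫ s in (0 : ℝ)..t, mean (u s))
    have hx : x = y + t * (u 0 y - mean (u 0)) + ∫ s in (0 : ℝ)..t, mean (u s) := by
      simp only at hy; linarith
    have hd := h.deriv_characteristics ht y
    rw [← hx] at hd
    have hpos := one_add_mul_pos_of_lt ha ht.1 hta (hlow y)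
    have hlo := hlow y
    have hu := hup y
    rw [eq_div_of_mul_eq hpos.ne' hd, abs_le, neg_le, ← neg_div]
    constructor
    · rw [div_le_div_iff₀ hpos h1]
      nlinarith
    · rcases le_total (deriv (u 0) y) 0 with hq | hq
      · exact (div_nonpos_of_nonpos_of_nonneg hq hpos.le).trans (by positivity)
      · refine (div_le_self hq ?_).trans (hu.trans htP)
        have := mul_nonneg ht.1 hq
        linarith
  refine le_antisymm (ciSup_le hb) ?_
  have hd := h.deriv_characteristics ht x₀
  rw [hx₀] at hd
  have e : 1 + t * -a = 1 - t * a := by ring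
  rw [e] at hd
  have h2 := le_ciSup (f := fun x => |deriv (u t) x|) ⟨_, forall_mem_range.2 hb⟩
    (x₀ + t * (u 0 x₀ - mean (u 0)) + ∫ s in (0 : ℝ)..t, mean (u s))
  simp only [eq_div_of_mul_eq h1.ne' hd, neg_div, abs_neg] at h2
  exact (le_abs_self _).trans h2

theorem IsMuBSolution.blowup {a P x₀ : ℝ} (ha : 0 < a) (h : IsMuBSolution (1 / a) u)
    (hx₀ : deriv (u 0) x₀ = -a) (hlow : ∀ x, -a ≤ deriv (u 0) x) (hup : ∀ x, deriv (u 0) x ≤ P)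
    (haP : a ≤ P) :
    Tendsto (fun t => supNorm (deriv (u t))) (𝓝[<] (1 / a)) atTop ∧
      ∃ t₀ ∈ Ico 0 (1 / a), StrictMonoOn (fun t => supNorm (deriv (u t))) (Ico t₀ (1 / a)) := by
  have hP : 0 < P := ha.trans_le haP
  have h0 : 0 ≤ 1 / a - 1 / P := sub_nonneg.2 (one_div_le_one_div_of_le ha haP)
  have hlt : 1 / a - 1 / P < 1 / a := sub_lt_self _ (by positivity)
  have hpos : ∀ t < 1 / a, 0 < 1 - t * a := fun t ht => by
    have := (lt_div_iff₀ ha).1 ht; linarith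
  -- The starting time `1/a - 1/P` is where `a / (1 - t a)` reaches `P`; it is nonnegative because
  -- `a ≤ P`.
  have hsup : ∀ t ∈ Ico (1 / a - 1 / P) (1 / a), supNorm (deriv (u t)) = a / (1 - t * a) := by
    intro t ht
    refine h.supNorm_deriv ha hx₀ hlow hup ⟨h0.trans ht.1, ht.2⟩ ht.2 ?_
    rw [le_div_iff₀ (hpos t ht.2)]
    have h1 : (1 / a - 1 / P) * (a * P) ≤ t * (a * P) :=
      mul_le_mul_of_nonneg_right ht.1 (by positivity)
    have h2 : (1 / a - 1 / P) * (a * P) = P - a := by field_simp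
    linarith
  refine ⟨?_, 1 / a - 1 / P, ⟨h0, hlt⟩, ?_⟩
  · have h1 : Tendsto (fun t => 1 - t * a) (𝓝[<] (1 / a)) (𝓝[>] 0) := by
      refine tendsto_nhdsWithin_iff.2 ⟨?_, ?_⟩
      · have : Tendsto (fun t => 1 - t * a) (𝓝 (1 / a)) (𝓝 (1 - 1 / a * a)) :=
          (by fun_prop : Continuous fun t : ℝ => 1 - t * a).tendsto _
        rw [one_div_mul_cancel ha.ne', sub_self] at this
        exact this.mono_left nhdsWithin_le_nhds
      · filter_upwards [self_mem_nhdsWithin] with t ht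
        exact hpos t ht
    refine (h1.inv_tendsto_nhdsGT_zero.const_mul_atTop ha).congr' ?_
    filter_upwards [Ico_mem_nhdsLT hlt] with t ht
    rw [hsup t ht, div_eq_mul_inv]
    rfl
  · intro s hs t ht hst
    simp only [hsup s hs, hsup t ht]
    exact div_lt_div_of_pos_left ha (hpos t ht.2) (by nlinarith)

/-- With equal means, `u` and `burgersFlow` take equal values on the same characteristics, and these
reach every point. -/
theorem IsMuBSolution.exists_extension (h : IsMuBSolution T u) {a : ℝ} (ha : 0 < a)
    (hT : T ≤ 1 / a) (hlow : ∀ x, -a ≤ deriv (u 0) x) {P : ℝ} (hup : ∀ x, deriv (u 0) x ≤ P)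
    (hP : 0 < P) {c : ℝ → ℝ} (hc : ContDiffOn ℝ ∞ c (Ici 0))
    (hm : ∀ t ∈ Ico 0 T, mean (u t) = c t) :
    ∃ w, IsMuBSolution (1 / a) w ∧ ∀ t ∈ Ico 0 T, w t = u t := by
  have hv := h.initial
  have hdv : deriv (fun y => u 0 y - mean (u 0)) = deriv (u 0) := by
    funext y; exact deriv_sub_const _
  -- Slightly negative times are included to provide the two-sided neighbourhood of `t = 0`.
  have hpos : ∀ t ∈ Ioo (-(1 / P)) (1 / a), ∀ y,
      0 < 1 + t * deriv (fun y => u 0 y - mean (u 0)) y := by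
    intro t ht y
    rw [hdv]
    rcases le_total 0 t with h0 | h0
    · exact one_add_mul_pos_of_lt ha h0 ht.2 (hlow y)
    · have h1 : -t * P < 1 := (lt_div_iff₀ hP).1 (by linarith [ht.1])
      have h2 : -t * deriv (u 0) y ≤ -t * P := mul_le_mul_of_nonneg_left (hup y) (by linarith)
      linarith
  have hP' : -(1 / P) < 0 := by simpa using hP
  have hev : ∀ t ∈ Ico 0 (1 / a), ∀ᶠ s in 𝓝 t, ∀ y,
      0 < 1 + s * deriv (fun y => u 0 y - mean (u 0)) y := fun t ht => by
    filter_upwards [Ioo_mem_nhds (hP'.trans_le ht.1) ht.2] with s hs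
    exact hpos s hs
  refine ⟨_, isMuBSolution_burgersFlow hv hc (by positivity) hev, fun t ht => funext fun x => ?_⟩
  have htT : t ∈ Ico 0 (1 / a) := ⟨ht.1, ht.2.trans_le hT⟩
  obtain ⟨y, hy⟩ := hv.surjective_flow t (x - ∫ s in (0 : ℝ)..t, c s)
  have hx : x = y + t * (u 0 y - mean (u 0)) + ∫ s in (0 : ℝ)..t, c s := by
    simp only at hy; linarith
  have hint : ∫ s in (0 : ℝ)..t, c s = ∫ s in (0 : ℝ)..t, mean (u s) := by
    refine intervalIntegral.integral_congr fun s hs => ?_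
    rw [uIcc_of_le ht.1] at hs
    exact (hm s ⟨hs.1, hs.2.trans_lt ht.2⟩).symm
  rw [hx, burgersFlow_eq hv (hev t htT).self_of_nhds y, hint, h.characteristics ht, hm t ht]

end BlowUp

end MuBurgers

/-! ### Assembly -/

theorem mainTheorem8 :
    -- (1) conserved integrals
    (∀ (T : ℝ) (u : ℝ → ℝ → ℝ), IsMuBSolution T u → ∀ p : ℕ, 1 ≤ p → ∀ t ∈ Ico 0 T,
      ∫ x in (0 : ℝ)..1, (u t x - mean (u t)) ^ p
        = ∫ x in (0 : ℝ)..1, (u 0 x - mean (u 0)) ^ p) ∧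
    -- (2) blow-up, at a time determined by the non-constant initial value
    (∀ u₀ : ℝ → ℝ, (¬ ∃ a : ℝ, ∀ x, u₀ x = a) → ∃ Tc : ℝ, 0 < Tc ∧
      ∀ (T : ℝ) (u : ℝ → ℝ → ℝ), IsMuBSolution T u → u 0 = u₀ →
        T ≤ Tc ∧
        (∀ c : ℝ → ℝ, ContDiffOn ℝ ∞ c (Ici 0) → (∀ t ∈ Ico 0 T, mean (u t) = c t) →
          ∃ w : ℝ → ℝ → ℝ, IsMuBSolution Tc w ∧ ∀ t ∈ Ico 0 T, w t = u t) ∧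
        (T = Tc →
          Tendsto (fun t => supNorm (deriv (u t))) (𝓝[<] Tc) atTop ∧
          ∃ t₀ ∈ Ico 0 Tc, StrictMonoOn (fun t => supNorm (deriv (u t))) (Ico t₀ Tc))) ∧
    -- (3) bihamiltonian structure: `J₀` and `J₂` are compatible Hamiltonian operators
    (∀ a b : ℝ, IsHamiltonian (fun m f x => a * J0 0 m f x + b * J2 m f x)) ∧
    -- the brackets of `J₀` involve `∂_x⁻³` only on functions of zero mean, and they do not
    -- depend on the constant of integration
    (∀ F G f g, IsFunctional F f → IsFunctional G g → ∀ m, IsSmoothPeriodic m →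
      mean (innerOp m (g m)) = 0 ∧ ∀ κ : ℝ, bracket (J0 κ) f g m = bracket (J0 0) f g m) ∧
    -- and μB is Hamiltonian for both
    (∃ (δH0 : (ℝ → ℝ) → ℝ → ℝ) (δH2 : ℝ → (ℝ → ℝ) → ℝ → ℝ),
      IsFunctional H0 δH0 ∧ (∀ c : ℝ, IsFunctional (H2 c) (δH2 c)) ∧
      (∀ u : ℝ → ℝ, IsSmoothPeriodic u →
        velocity (mean u) (momentum u) = u ∧
        H2 (mean u) (momentum u) = -(1 / 6) * ∫ x in (0 : ℝ)..1, u x ^ 3 ∧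
        ∀ x : ℝ,
          J0 (3 * mean u) (momentum u) (δH0 (momentum u)) x
            = -u x * deriv (momentum u) x - 3 * deriv u x * momentum u x ∧
          J2 (momentum u) (δH2 (mean u) (momentum u)) x
            = -u x * deriv (momentum u) x - 3 * deriv u x * momentum u x) ∧
      (∀ (T : ℝ) (u : ℝ → ℝ → ℝ), IsSmoothCurve T u →
        (IsMuBSolution T u ↔ ∀ t ∈ Ico 0 T, ∀ x : ℝ,
          timeDeriv T (fun s => momentum (u s)) t x
            = J0 (3 * mean (u t)) (momentum (u t)) (δH0 (momentum (u t))) x) ∧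
        (IsMuBSolution T u ↔ ∀ t ∈ Ico 0 T, ∀ x : ℝ,
          timeDeriv T (fun s => momentum (u s)) t x
            = J2 (momentum (u t)) (δH2 (mean (u t)) (momentum (u t))) x))) := by
  refine ⟨fun T u h p _ t ht => h.integral_pow p ht, fun u₀ hne => ?_, isHamiltonian_pencil,
    fun F G f g hF hG m hm => ⟨hG.mean_innerOp hm, fun κ => bracket_J0_eq hF hG hm κ⟩,
    fun _ _ => -(9 / 2),
    fun c m x => 1 / 2 * invD^[2] (fun y => velocity c m y * velocity c m y) x,
    isFunctional_H0, isFunctional_H2, fun u hu => ⟨velocity_momentum hu, ?_, fun x =>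
      ⟨J0_H0_eq hu x, J2_H2_eq hu x⟩⟩, fun T u hu => ⟨?_, ?_⟩⟩
  · by_cases hu₀ : IsSmoothPeriodic u₀
    · obtain ⟨x₀, hx₀⟩ := hu₀.deriv.neg.exists_le
      obtain ⟨x₁, hx₁⟩ := hu₀.deriv.exists_le
      have ha : 0 < -deriv u₀ x₀ := by
        by_contra! hle
        exact hne (hu₀.const_of_deriv_nonneg fun x => by linarith [hx₀ x])
      have hlow : ∀ x, -(-deriv u₀ x₀) ≤ deriv u₀ x := fun x => by linarith [hx₀ x]
      -- The maximum with `a = -min u₀'` ensures `a ≤ P`, as the blow-up argument requires.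
      have hup : ∀ x, deriv u₀ x ≤ max (-deriv u₀ x₀) (deriv u₀ x₁) := fun x =>
        (hx₁ x).trans (le_max_right _ _)
      refine ⟨1 / -deriv u₀ x₀, by positivity, fun T u h hu => ?_⟩
      subst hu
      have hT := h.le_of_deriv_eq ha (neg_neg (deriv (u 0) x₀)).symm
      refine ⟨hT, fun c hc hm => h.exists_extension ha hT hlow hup (lt_max_of_lt_left ha) hc hm,
        fun hTc => ?_⟩
      subst hTc
      exact h.blowup ha (neg_neg _).symm hlow hup (le_max_left _ _)
    · exact ⟨1, one_pos, fun T u h hu => absurd (hu ▸ h.curve.slice h.zero_mem) hu₀⟩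
  · rw [H2, velocity_momentum hu]
  · rw [hu.isMuBSolution_iff]
    exact forall₂_congr fun t ht => forall_congr' fun x => by rw [J0_H0_eq (hu.slice ht)]
  · rw [hu.isMuBSolution_iff]
    exact forall₂_congr fun t ht => forall_congr' fun x => by rw [J2_H2_eq (hu.slice ht)]
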